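/- **Setting.** Let $P$ be a finite nonempty set of $n=|P|$ points with a similarity measure $\mu:P\times P\to\mathbb R$, and for every $p\in P$ let $\pi_p:\{1,\dots,n\}\to P$ be a bijection with $\mu(p,\pi_p(1))\ge\mu(p,\pi_p(2))\ge\dots\ge\mu(p,\pi_p(n))$. Let $\mathcal H$ be a probability distribution on hash functions $h:P\to U$ into a linearly ordered set $U$, such that one evaluation of a hash function takes at most $\mathrm{Time}(\mathcal H)\ge 1$ steps. Let $k\ge1$, $M\ge 1$ be integers, $\rho\in[0,1]$ and $\delta\in(0,1)$. A family $\mathcal A=\{\mathcal A_p\}_{p\in P}$ of subsets of $P$ is a *$(k,\rho,M)$-ANN family* with respect to $\mathcal H$ if for every $p\in P$ the set $\mathcal A_p$ consists of the first $m$ elements of the sequence $\pi_p(1),\dots,\pi_p(n)$ for some $m$ with $k\le m\le n$, and there is an integer $0\le\ell\le M$ such that, for independent $h_1,\dots,h_\ell\sim\mathcal H$, $\Pr[\forall j\le\ell:\ h_j(p)=h_j(\pi_p(i))]\ge n^{-\rho}$ for all $1\le i\le k$, and $\Pr[\forall j\le\ell:\ h_j(p)=h_j(x)]\le n^{-4}$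 for all $x\notin\mathcal A_p$. **Algorithm (Stars 2, with constants $c_1,c_2$).** Put $W=16k$, $R=\lceil c_1n^\rho\log n\rceil$ and $s=\lceil c_2\delta^{-1}n^\rho\log^2n\rceil$. Repeat the following independently $R$ times. Draw independent $h_1,\dots,h_M\sim\mathcal H$. Sort the points $x$ lexicographically by $(h_1(x),\dots,h_M(x))$. Draw a uniformly random integer $r\in\{W/2,\dots,W\}$ and split the sorted sequence into consecutive blocks, the first one of size $r$ and all further ones of size $W$ (the last block may be shorter). If $k>n^{2\rho}$, draw in each block $s$ independent uniformly random leaders (with replacement) and create an edge between each leader and every point of its block. If $k\le n^{2\rho}$, create an edge between every two points of each block. An edge $(x,y)$ has weight $\mu(x,y)$. The output is the graph $G=(P,E)$ formed by all edges created. Running time is counted in elementary steps; a comparison of two elements of $U$, the drawing of a hash function or of a random integer, and the creation of an edge with its weight each take $O(1)$ steps. **Theorem.** There are absolute constants $\kappa,b$ and a function $f:\mathbb R\to\mathbb R$ such that for every $a>0$, every sufficiently large $c_1$ (depending only on $a$) and every $c_2\ge f(c_1)$ there is a constant $C$ (depending only on $a,c_1,c_2$) such that, in the above setting and for every $(k,\rho,M)$-ANN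 family $\mathcal A$ with respect to $\mathcal H$, the graph $G$ produced by Stars 2 satisfies the following. 1. For $p\in P$ let $\hat G_p$ be the subgraph of $G$ induced by $\mathcal A_p\cup\{p\}$, and let $\mathcal N^2_{\hat G_p}(p)$ be the set of vertices at distance at most $2$ from $p$ in $\hat G_p$ (including $p$ itself). With probability at least $1-n^{-a}$, one has $|\mathcal N^2_{\hat G_p}(p)|\ge(1-\delta)k$ for every $p\in P$. 2. For all outcomes of the random choices, $|E(G)|\le C\,\delta^{-1}n^{1+\kappa\rho}(1+\log n)^b$. 3. For all outcomes of the random choices, the running time is at most $C\,\delta^{-1}n^{1+\kappa\rho}(1+\log n)^b\cdot M\cdot\mathrm{Time}(\mathcal H)$. In particular the bounds in 2 and 3 do not depend on $k$. -/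

import Mathlib

open MeasureTheory

/-! ### Programs with a step count -/

/-- The outcome of running a program: the value it returns and the number of steps it has taken. -/
structure Timed (α : Type*) where
  val : α
  time : ℕ

namespace Timed

/-- Sequential composition: run `x`, then run `f` on the value returned; the steps add up. -/
def bind {α β : Type*} (x : Timed α) (f : α → Timed β) : Timed β :=
  ⟨(f x.val).val, x.time + (f x.val).time⟩

/-- One call per element of the list, plus one step per list cell. -/
def map {α β : Type*} (f : α → Timed β) : List α → Timed (List β)
  | [] => ⟨[], 1⟩
  | a :: as => (f a).bind fun b => (map f as).bind fun bs => ⟨b :: bs, 1⟩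

/-- `flatMap f j [a₀, a₁, …]` returns the concatenation of `f j a₀`, `f (j+1) a₁`, …;
a concatenation takes as many steps as its left operand has elements. -/
def flatMap {α β : Type*} (f : ℕ → α → Timed (List β)) : ℕ → List α → Timed (List β)
  | _, [] => ⟨[], 1⟩
  | j, a :: as => (f j a).bind fun b => (flatMap f (j + 1) as).bind fun c => ⟨b ++ c, b.length + 1⟩

/-- The length of a list, by traversal. -/
def length {α : Type*} : List α → Timed ℕ
  | [] => ⟨0, 1⟩
  | _ :: as => (length as).bind fun m => ⟨m + 1, 1⟩

/-- The `i`-th element of a list (counted from `0`), by traversal. -/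
def nth {α : Type*} : List α → ℕ → Timed (Option α)
  | [], _ => ⟨none, 1⟩
  | a :: _, 0 => ⟨some a, 1⟩
  | _ :: as, i + 1 => (nth as i).bind fun o => ⟨o, 1⟩

/-- The first `m` elements of a list and the remaining ones. -/
def splitAt {α : Type*} : ℕ → List α → Timed (List α × List α)
  | 0, as => ⟨([], as), 1⟩
  | _ + 1, [] => ⟨([], []), 1⟩
  | m + 1, a :: as => (splitAt m as).bind fun s => ⟨(a :: s.1, s.2), 1⟩

theorem splitAt_snd_length_le {α : Type*} (m : ℕ) (as : List α) :
    (splitAt m as).val.2.length ≤ as.length := by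
  induction as generalizing m with
  | nil => cases m <;> simp [splitAt]
  | cons a as ih =>
    cases m with
    | zero => simp [splitAt]
    | succ m => simpa [splitAt, bind] using Nat.le_succ_of_le (ih m)

/-- Cut a list into consecutive chunks of `W` elements (the last one may be shorter). -/
def chunks {α : Type*} (W : ℕ) : List α → Timed (List (List α))
  | [] => ⟨[], 1⟩
  | a :: as =>
    let s := splitAt (W - 1) as
    let rest := chunks W s.val.2
    ⟨(a :: s.val.1) :: rest.val, s.time + rest.time + 1⟩
termination_by as => as.length
decreasing_by
  exact Nat.lt_succ_of_le (splitAt_snd_length_le _ _)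

/-- Split a list into consecutive blocks: the first block has `r` elements, the following ones
have `W` elements (the last one may be shorter). -/
def blocks {α : Type*} (W r : ℕ) (as : List α) : Timed (List (List α)) :=
  (splitAt r as).bind fun s => (chunks W s.2).bind fun rest => ⟨s.1 :: rest, 1⟩

/-- Lexicographic comparison of two keys, one step per coordinate inspected. -/
def lexLE {U : Type*} [LinearOrder U] : List U → List U → Timed Bool
  | [], _ => ⟨true, 1⟩
  | _ :: _, [] => ⟨false, 1⟩
  | a :: as, b :: bs =>
    if a < b then ⟨true, 1⟩
    else if b < a then ⟨false, 1⟩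
    else (lexLE as bs).bind fun c => ⟨c, 1⟩

/-- Deal the elements of a list alternately onto two lists. -/
def halve {α : Type*} : List α → Timed (List α × List α)
  | [] => ⟨([], []), 1⟩
  | a :: as => (halve as).bind fun s => ⟨(a :: s.2, s.1), 1⟩

theorem halve_length {α : Type*} (as : List α) :
    (halve as).val.1.length = (as.length + 1) / 2 ∧ (halve as).val.2.length = as.length / 2 := by
  induction as with
  | nil => simp [halve]
  | cons a as ih =>
    have h1 := ih.1
    have h2 := ih.2
    simp only [halve, bind, List.length_cons]
    omega

/-- Merge two sorted lists, with the comparison procedure `le`. -/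
def merge {α : Type*} (le : α → α → Timed Bool) : List α → List α → Timed (List α)
  | [], bs => ⟨bs, 1⟩
  | a :: as, [] => ⟨a :: as, 1⟩
  | a :: as, b :: bs =>
    let c := le a b
    if c.val then
      let rest := merge le as (b :: bs)
      ⟨a :: rest.val, c.time + rest.time + 1⟩
    else
      let rest := merge le (a :: as) bs
      ⟨b :: rest.val, c.time + rest.time + 1⟩
termination_by as bs => as.length + bs.length

/-- Merge sort, with the comparison procedure `le`. -/
def mergeSort {α : Type*} (le : α → α → Timed Bool) : List α → Timed (List α)
  | [] => ⟨[], 1⟩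
  | [a] => ⟨[a], 1⟩
  | a :: b :: as =>
    let s := halve (a :: b :: as)
    let l := mergeSort le s.val.1
    let r := mergeSort le s.val.2
    let m := merge le l.val r.val
    ⟨m.val, s.time + l.time + r.time + m.time + 1⟩
termination_by as => as.length
decreasing_by
  · have := (halve_length (a :: b :: as)).1
    simp only [List.length_cons] at this ⊢
    omega
  · have := (halve_length (a :: b :: as)).2
    simp only [List.length_cons] at this ⊢
    omega

end Timed

/-! ### Nearest neighbor orderings and ANN families -/

/-- `π p` lists the points by non-increasing similarity to `p`; the `i`-th nearest neighbor of `p`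
in the usual counting from `1` is `π p (i - 1)`. -/
def IsNeighborOrdering {P : Type*} [Fintype P] (μ : P → P → ℝ)
    (π : P → Fin (Fintype.card P) ≃ P) : Prop :=
  ∀ p : P, Antitone fun i => μ p (π p i)

/-- The probability that `ℓ` independent draws `h₁, …, h_ℓ` from the hash family (`h ω` with `ω`
distributed according to `ν`) satisfy `(h₁(p), …, h_ℓ(p)) = (h₁(x), …, h_ℓ(x))`. -/
noncomputable def collisionProb {Ω P U : Type*} [MeasurableSpace Ω] (ν : Measure Ω)
    (h : Ω → P → U) (ℓ : ℕ) (p x : P) : ℝ :=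
  (Measure.pi fun _ : Fin ℓ => ν).real {ω | ∀ j, h (ω j) p = h (ω j) x}

/-- `A` is a `(k, ρ, M)`-ANN family with respect to the hash family `(ν, h)`, for the nearest
neighbor ordering `π`. -/
def IsANNFamily {Ω P U : Type*} [Fintype P] [MeasurableSpace Ω] (ν : Measure Ω) (h : Ω → P → U)
    (π : P → Fin (Fintype.card P) ≃ P) (k : ℕ) (ρ : ℝ) (M : ℕ) (A : P → Set P) : Prop :=
  ∀ p : P,
    (∃ m : ℕ, k ≤ m ∧ m ≤ Fintype.card P ∧
      A p = π p '' {i : Fin (Fintype.card P) | (i : ℕ) < m}) ∧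
    ∃ ℓ : ℕ, ℓ ≤ M ∧
      (∀ i : Fin (Fintype.card P), (i : ℕ) < k →
        (Fintype.card P : ℝ) ^ (-ρ) ≤ collisionProb ν h ℓ p (π p i)) ∧
      (∀ x : P, x ∉ A p → collisionProb ν h ℓ p x ≤ (Fintype.card P : ℝ) ^ (-4 : ℝ))

/-! ### The algorithm Stars 2 -/

/-- The number of repetitions, `c₁ n^ρ log n` rounded up. -/
noncomputable def numReps (c₁ ρ : ℝ) (n : ℕ) : ℕ :=
  ⌈c₁ * (n : ℝ) ^ ρ * Real.log n⌉₊

/-- The number of leaders sampled in each block, `c₂ δ⁻¹ n^ρ log² n` rounded up. -/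
noncomputable def numLeaders (c₂ δ ρ : ℝ) (n : ℕ) : ℕ :=
  ⌈c₂ * δ⁻¹ * (n : ℝ) ^ ρ * Real.log n ^ 2⌉₊

/-- The randomness of one repetition: the indices of the `M` hash functions; the number `i` that
determines the shift `r = 8k + i` in `{W/2, …, W}`, where `W = 16k`; and for every triple
`(j, t, m)` an element of `{0, …, m}`, which is the position of the `t`-th leader of the `j`-th
block in case that block has `m + 1` elements. -/
abbrev RepTape (Ω : Type*) (k M : ℕ) : Type _ :=
  (Fin M → Ω) × Fin (8 * k + 1) × ((c : ℕ × ℕ × ℕ) → Fin (c.2.2 + 1))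

/-- The law of the randomness of one repetition: everything is independent, the hash functions are
drawn from the hash family, all other items are uniformly distributed. -/
noncomputable def repTapeMeasure {Ω : Type*} [MeasurableSpace Ω] (ν : Measure Ω) (k M : ℕ) :
    Measure (RepTape Ω k M) :=
  (Measure.pi fun _ : Fin M => ν).prod
    ((PMF.uniformOfFintype (Fin (8 * k + 1))).toMeasure.prod
      (Measure.infinitePi fun c : ℕ × ℕ × ℕ => (PMF.uniformOfFintype (Fin (c.2.2 + 1))).toMeasure))

/-- The law of the randomness of `R` independent repetitions. -/
noncomputable def tapeMeasure {Ω : Type*} [MeasurableSpace Ω] (ν : Measure Ω) (k M R : ℕ) :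
    Measure (Fin R → RepTape Ω k M) :=
  Measure.pi fun _ : Fin R => repTapeMeasure ν k M

section Stars

variable {Ω P U : Type*} [LinearOrder U]

/-- Evaluate the `M` hash functions at a point; `timeH ω x` is the number of steps that the
evaluation of `h ω` at `x` takes. The point is stored together with its key. -/
def hashKey (h : Ω → P → U) (timeH : Ω → P → ℕ) {M : ℕ} (ω : Fin M → Ω) (x : P) :
    Timed (List U × P) :=
  (Timed.map (fun j => ⟨h (ω j) x, timeH (ω j) x⟩) (List.finRange M)).bind fun key => ⟨(key, x), 1⟩

/-- The points, sorted lexicographically by their hash values. -/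
def sortedPoints (h : Ω → P → U) (timeH : Ω → P → ℕ) {M : ℕ} (ω : Fin M → Ω) (pts : List P) :
    Timed (List P) :=
  (Timed.map (hashKey h timeH ω) pts).bind fun keyed =>
    (Timed.mergeSort (fun a b => Timed.lexLE a.1 b.1) keyed).bind fun sorted =>
      Timed.map (fun a => ⟨a.2, 1⟩) sorted

/-- For each of `s` leaders `y` of the block `B`, the weighted edges `(x, y)` with `x ∈ B`.
The position of the `t`-th leader in a block with `m + 1` elements is `leader t m`. -/
def leaderEdges (μ : P → P → ℝ) (s : ℕ) (leader : (t m : ℕ) → Fin (m + 1)) (B : List P) :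
    Timed (List (P × P × ℝ)) :=
  (Timed.length B).bind fun len =>
    Timed.flatMap
      (fun _ t => (Timed.nth B (leader t (len - 1))).bind fun o =>
        match o with
        | none => ⟨[], 1⟩
        | some y => Timed.map (fun x => ⟨(x, y, μ x y), 1⟩) B)
      0 (List.range s)

/-- All weighted edges `(x, y)` with `x, y ∈ B`. -/
def allPairsEdges (μ : P → P → ℝ) (B : List P) : Timed (List (P × P × ℝ)) :=
  Timed.flatMap (fun _ y => Timed.map (fun x => ⟨(x, y, μ x y), 1⟩) B) 0 B

/-- One repetition of the algorithm, on the input points `pts` and with randomness `τ`. Drawing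
the `M` hash functions and the shift and testing the branch condition takes `M + 2` steps. -/
noncomputable def starsRep (μ : P → P → ℝ) (h : Ω → P → U) (timeH : Ω → P → ℕ) (k M : ℕ)
    (ρ : ℝ) (s : ℕ) (pts : List P) (τ : RepTape Ω k M) : Timed (List (P × P × ℝ)) :=
  (⟨(), M + 2⟩ : Timed Unit).bind fun _ =>
    (sortedPoints h timeH τ.1 pts).bind fun sorted =>
      (Timed.blocks (16 * k) (8 * k + τ.2.1) sorted).bind fun Bs =>
        if (pts.length : ℝ) ^ (2 * ρ) < k then
          Timed.flatMap (fun j B => leaderEdges μ s (fun t m => τ.2.2 (j, t, m)) B) 0 Bs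
        else
          Timed.flatMap (fun _ B => allPairsEdges μ B) 0 Bs

/-- The algorithm with `R` repetitions; it returns the list of all weighted edges created. -/
noncomputable def stars (μ : P → P → ℝ) (h : Ω → P → U) (timeH : Ω → P → ℕ) (k M : ℕ)
    (ρ : ℝ) (s R : ℕ) (pts : List P) (τ : Fin R → RepTape Ω k M) : Timed (List (P × P × ℝ)) :=
  Timed.flatMap (fun _ i => starsRep μ h timeH k M ρ s pts (τ i)) 0 (List.finRange R)

end Stars

/-- The (undirected, loopless) graph with a given list of weighted edges. -/
def edgeListGraph {P : Type*} (es : List (P × P × ℝ)) : SimpleGraph P :=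
  SimpleGraph.fromRel fun x y => ∃ w, (x, y, w) ∈ es

/-- The `k`-hop neighborhood of `v`: the vertices at distance at most `k` from `v`, among them `v`
itself. -/
def hopNeighborhood {V : Type*} (G : SimpleGraph V) (k : ℕ) (v : V) : Set V :=
  {u | G.edist v u ≤ k}

/-- The two-hop neighborhood of `p` in the subgraph of `G` induced by `S ∪ {p}`. -/
def inducedTwoHop {P : Type*} (G : SimpleGraph P) (S : Set P) (p : P) : Set ↥(S ∪ {p}) :=
  hopNeighborhood (G.induce (S ∪ {p})) 2 ⟨p, Or.inr rfl⟩

/-! Fix a point `p` with its number `ℓ` of hash functions, and let `C` be the set of points that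
agree with `p` on the first `ℓ` hash values. Truncating keys to `ℓ` coordinates preserves the
lexicographic order, so `C` is contiguous in the sorted sequence (`mem_collisionClass_of_between`).

Call a repetition good for a near neighbor `x` of `p` if `x ∈ C ⊆ A p` and all positions within `k`
of `p` fall into one block. The hash condition has probability at least `n^(-ρ) - n * n^(-4)` by a
union bound over the points outside `A p`. Given the hash values, at least half of the shifts
qualify (`card_le_two_mul_card_goodShifts`). With about `c₁ n^ρ log n` repetitions, every near
neighbor therefore has a good one, except with polynomially small probability. In a good repetition,
either `x` shares the block of `p`, or `k` points of `C` between `p` and `x` do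
(`mem_blockOf_or_le_ncard`).

Let `K i` be the part of `C` in the block of `p` in repetition `i`, and put `θ = δ k / R`. If `K i`
has at least `θ` points, a leader lands in it with high probability, since a block has at most `16
k` points (`measure_missingLeaders_le`). In a good repetition that leader lies in `A p` and links
`p` to all of `K i` by two hops. If all pairs are joined, `p` itself plays the leader. The sets `K
i` with fewer than `θ` points lose at most `R θ = δ k` near neighbors in total
(`sub_le_ncard_of_cover`), so `(1 - δ) k` points remain.

The cost does not depend on `k`: per repetition and point there are at most `s` edges with leaders,
and at most `16 k ≤ 16 n^(2ρ)` edges in the other branch. The factor `R` brings the exponent to `1 +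
3ρ` (`resource_bounds`). Hashing and merge sort contribute only a factor `M T` and logarithms. -/

/-! ### Values and running times of the list procedures -/

namespace Timed

variable {α β : Type*}

@[simp] theorem bind_val (x : Timed α) (f : α → Timed β) : (x.bind f).val = (f x.val).val := rfl

@[simp] theorem bind_time (x : Timed α) (f : α → Timed β) :
    (x.bind f).time = x.time + (f x.val).time := rfl

@[simp] theorem map_val (f : α → Timed β) (l : List α) :
    (map f l).val = l.map fun a => (f a).val := by
  induction l with
  | nil => simp [map]
  | cons a as ih => simp [map, ih]

theorem map_time_le {f : α → Timed β} {l : List α} {c : ℕ} (h : ∀ a ∈ l, (f a).time ≤ c) :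
    (map f l).time ≤ (c + 1) * l.length + 1 := by
  induction l with
  | nil => simp [map]
  | cons a as ih =>
    have h1 := ih fun b hb => h b (List.mem_cons_of_mem _ hb)
    have h2 := h a List.mem_cons_self
    simp only [map, bind_time, List.length_cons]
    nlinarith

theorem mem_flatMap {f : ℕ → α → Timed (List β)} {j : ℕ} {l : List α} {b : β} :
    b ∈ (flatMap f j l).val ↔ ∃ i a, l[i]? = some a ∧ b ∈ (f (j + i) a).val := by
  induction l generalizing j with
  | nil => simp [flatMap]
  | cons a as ih =>
    simp only [flatMap, bind_val, List.mem_append, ih]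
    constructor
    · rintro (h | ⟨i, c, hi, hc⟩)
      · exact ⟨0, a, by simp, by simpa using h⟩
      · exact ⟨i + 1, c, by simpa using hi, by rwa [← add_assoc, add_right_comm]⟩
    · rintro ⟨_ | i, c, hi, hc⟩
      · left
        simp only [List.getElem?_cons_zero, Option.some.injEq] at hi
        subst hi
        simpa using hc
      · right
        exact ⟨i, c, by simpa using hi, by rwa [add_right_comm, add_assoc]⟩

theorem flatMap_length_le {f : ℕ → α → Timed (List β)} {l : List α} {g : α → ℕ}
    (h : ∀ j, ∀ a ∈ l, (f j a).val.length ≤ g a) (j : ℕ) :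
    (flatMap f j l).val.length ≤ (l.map g).sum := by
  induction l generalizing j with
  | nil => simp [flatMap]
  | cons a as ih =>
    have h1 := ih (fun i b hb => h i b (List.mem_cons_of_mem _ hb)) (j + 1)
    have h2 := h j a List.mem_cons_self
    simp only [flatMap, bind_val, List.length_append, List.map_cons, List.sum_cons]
    omega

theorem flatMap_time_le {f : ℕ → α → Timed (List β)} {l : List α} {g : α → ℕ}
    (h : ∀ j, ∀ a ∈ l, (f j a).time + (f j a).val.length + 1 ≤ g a) (j : ℕ) :
    (flatMap f j l).time ≤ (l.map g).sum + 1 := by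
  induction l generalizing j with
  | nil => simp [flatMap]
  | cons a as ih =>
    have h1 := ih (fun i b hb => h i b (List.mem_cons_of_mem _ hb)) (j + 1)
    have h2 := h j a List.mem_cons_self
    simp only [flatMap, bind_time, List.map_cons, List.sum_cons]
    omega

@[simp] theorem length_val (l : List α) : (length l).val = l.length := by
  induction l with
  | nil => rfl
  | cons a as ih => simp [length, ih]

@[simp] theorem length_time (l : List α) : (length l).time = l.length + 1 := by
  induction l with
  | nil => rfl
  | cons a as ih => simp [length, ih]

@[simp] theorem nth_val (l : List α) (i : ℕ) : (nth l i).val = l[i]? := by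
  induction l generalizing i with
  | nil => simp [nth]
  | cons a as ih => cases i <;> simp [nth, ih]

theorem nth_time_le (l : List α) (i : ℕ) : (nth l i).time ≤ l.length + 1 := by
  induction l generalizing i with
  | nil => simp [nth]
  | cons a as ih =>
    cases i with
    | zero => simp [nth]
    | succ i => simpa [nth] using ih i

@[simp] theorem splitAt_val (m : ℕ) (l : List α) : (splitAt m l).val = (l.take m, l.drop m) := by
  induction l generalizing m with
  | nil => cases m <;> simp [splitAt]
  | cons a as ih => cases m <;> simp [splitAt, ih]

theorem splitAt_time_le (m : ℕ) (l : List α) : (splitAt m l).time ≤ (l.take m).length + 1 := by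
  induction l generalizing m with
  | nil => cases m <;> simp [splitAt]
  | cons a as ih =>
    cases m with
    | zero => simp [splitAt]
    | succ m => simpa [splitAt] using ih m

theorem chunks_getElem? {W : ℕ} (hW : 1 ≤ W) (l : List α) (j : ℕ) (hj : j * W < l.length) :
    (chunks W l).val[j]? = some ((l.drop (j * W)).take W) := by
  obtain ⟨w, rfl⟩ : ∃ w, W = w + 1 := ⟨W - 1, by omega⟩
  induction j generalizing l with
  | zero =>
    cases l with
    | nil => simp at hj
    | cons a as => rw [chunks]; simp
  | succ j ih =>
    cases l with
    | nil => simp at hj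
    | cons a as =>
      rw [chunks]
      simp only [splitAt_val, Nat.add_sub_cancel, List.getElem?_cons_succ]
      rw [ih]
      · rw [List.drop_drop, show (j + 1) * (w + 1) = (w + j * (w + 1)) + 1 by ring,
          List.drop_succ_cons]
      · simp only [List.length_cons, List.length_drop] at hj ⊢
        have : (j + 1) * (w + 1) = (w + j * (w + 1)) + 1 := by ring
        omega

theorem chunks_flatten (W : ℕ) (l : List α) : (chunks W l).val.flatten = l := by
  induction hn : l.length using Nat.strong_induction_on generalizing l with
  | _ n ih =>
    cases l with
    | nil => rw [chunks]; simp
    | cons a as =>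
      rw [chunks]
      simp only [splitAt_val, List.flatten_cons]
      rw [ih _ _ _ rfl]
      · simp
      · simp at hn ⊢; omega

/-- A chunk always receives the head of the list, so `W = 0` behaves like `W = 1`; hence `W - 1 + 1`
in place of `W`. -/
theorem chunks_length_le (W : ℕ) (l : List α) : ∀ B ∈ (chunks W l).val, B.length ≤ W - 1 + 1 := by
  induction hn : l.length using Nat.strong_induction_on generalizing l with
  | _ n ih =>
    cases l with
    | nil => rw [chunks]; simp
    | cons a as =>
      rw [chunks]
      simp only [splitAt_val, List.mem_cons]
      rintro B (rfl | hB)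
      · simp
      · refine ih _ ?_ _ rfl B hB
        simp at hn ⊢; omega

theorem length_chunks_le (W : ℕ) (l : List α) : (chunks W l).val.length ≤ l.length := by
  induction hn : l.length using Nat.strong_induction_on generalizing l with
  | _ n ih =>
    cases l with
    | nil => rw [chunks]; simp
    | cons a as =>
      rw [chunks]
      simp only [splitAt_val, List.length_cons] at hn ⊢
      have := ih (as.drop (W - 1)).length (by simp; omega) _ rfl
      simp only [List.length_drop] at this
      omega

theorem chunks_time_le (W : ℕ) (l : List α) : (chunks W l).time ≤ 2 * l.length + 1 := by
  induction hn : l.length using Nat.strong_induction_on generalizing l with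
  | _ n ih =>
    cases l with
    | nil => rw [chunks]; simp
    | cons a as =>
      rw [chunks]
      simp only [splitAt_val, List.length_cons] at hn ⊢
      have h1 := ih (as.drop (W - 1)).length (by simp; omega) _ rfl
      have h2 := splitAt_time_le (W - 1) as
      simp only [List.length_drop, List.length_take] at h1 h2
      omega

theorem blocks_val (W r : ℕ) (l : List α) :
    (blocks W r l).val = l.take r :: (chunks W (l.drop r)).val := by
  simp [blocks]

theorem blocks_flatten (W r : ℕ) (l : List α) :
    (blocks W r l).val.flatten = l := by
  simp [blocks_val, chunks_flatten]

theorem blocks_time_le (W r : ℕ) (l : List α) : (blocks W r l).time ≤ 2 * l.length + 3 := by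
  have h1 := splitAt_time_le r l
  have h2 := chunks_time_le W (l.drop r)
  simp only [blocks, bind_time, splitAt_val, List.length_drop, List.length_take] at h1 h2 ⊢
  omega

/-- The extra 1 pays for the first block, which is present even if empty. -/
theorem length_blocks_le (W r : ℕ) (l : List α) : (blocks W r l).val.length ≤ l.length + 1 := by
  have h := length_chunks_le W (l.drop r)
  simp only [blocks_val, List.length_cons, List.length_drop] at h ⊢
  omega

theorem blocks_length_le {W r : ℕ} (hW : 1 ≤ W) (hr : r ≤ W) (l : List α) :
    ∀ B ∈ (blocks W r l).val, B.length ≤ W := by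
  rw [blocks_val]
  rintro B (_ | ⟨_, hB⟩)
  · simp only [List.length_take]; omega
  · have := chunks_length_le _ _ B hB
    omega

/-- The block of the element at position `q` has index `(q + W - r) / W`. -/
theorem mem_block_of_index {W r : ℕ} (hW : 1 ≤ W) (hr : r ≤ W) (l : List α) {q : ℕ}
    (hq : q < l.length) :
    ∃ B, (blocks W r l).val[(q + W - r) / W]? = some B ∧
      ∀ q' x, (q' + W - r) / W = (q + W - r) / W → l[q']? = some x → x ∈ B := by
  rw [blocks_val]
  rcases lt_or_ge q r with h | h
  · have h0 : (q + W - r) / W = 0 := Nat.div_eq_of_lt (by omega)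
    refine ⟨l.take r, by simp [h0], fun q' x hq' hx => ?_⟩
    rw [h0, Nat.div_eq_zero_iff] at hq'
    exact List.mem_of_getElem? (i := q') (by rw [List.getElem?_take_of_lt (by omega)]; exact hx)
  · have key : ∀ q', r ≤ q' → (q' + W - r) / W = (q' - r) / W + 1 := fun q' h' => by
      rw [show q' + W - r = q' - r + W by omega, Nat.add_div_right _ (by omega)]
    have hlt : (q - r) / W * W ≤ q - r := Nat.div_mul_le_self _ _
    refine ⟨((l.drop r).drop ((q - r) / W * W)).take W, ?_, fun q' x hq' hx => ?_⟩
    · rw [key q h, List.getElem?_cons_succ]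
      exact chunks_getElem? hW _ _ (by simp; omega)
    · have hq'r : r ≤ q' := by
        by_contra hc
        rw [Nat.div_eq_of_lt (a := q' + W - r) (by omega), key q h] at hq'
        exact Nat.succ_ne_zero _ hq'.symm
      rw [key q h, key q' hq'r, Nat.add_right_cancel_iff] at hq'
      have h1 : (q - r) / W * W ≤ q' - r := by rw [← hq']; exact Nat.div_mul_le_self _ _
      have h2 : q' - r < (q - r) / W * W + W := by
        rw [← hq']; exact Nat.lt_div_mul_add (by omega)
      refine List.mem_of_getElem? (i := q' - r - (q - r) / W * W) ?_
      rw [List.getElem?_take_of_lt (by omega), List.getElem?_drop, List.getElem?_drop, ← hx]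
      congr 1
      omega

/-! ### Sorting -/

theorem lexLE_val {U : Type*} [LinearOrder U] (as bs : List U) :
    (lexLE as bs).val = decide (as ≤ bs) := by
  simp only [← not_lt]
  induction as generalizing bs with
  | nil => simp [lexLE]
  | cons a as ih =>
    cases bs with
    | nil => simp [lexLE]
    | cons b bs =>
      rw [lexLE]
      rcases lt_trichotomy a b with h | h | h
      · simp [h, List.cons_lt_cons_iff, h.not_gt, h.ne']
      · subst h; simp [ih]
      · simp [h, h.not_gt, List.cons_lt_cons_iff]

theorem lexLE_time_le {U : Type*} [LinearOrder U] (as bs : List U) :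
    (lexLE as bs).time ≤ as.length + 1 := by
  induction as generalizing bs with
  | nil => simp [lexLE]
  | cons a as ih =>
    cases bs with
    | nil => simp [lexLE]
    | cons b bs =>
      rw [lexLE]
      split_ifs
      · simp
      · simp
      · simpa using ih bs

theorem halve_perm (l : List α) : ((halve l).val.1 ++ (halve l).val.2).Perm l := by
  induction l with
  | nil => simp [halve]
  | cons a as ih =>
    simp only [halve, bind_val, List.cons_append, List.perm_cons]
    exact List.perm_append_comm.trans ih

theorem halve_time (l : List α) : (halve l).time = l.length + 1 := by
  induction l with
  | nil => rfl
  | cons a as ih => simp [halve, ih]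

theorem halve_map (f : α → β) (l : List α) :
    (halve (l.map f)).val = ((halve l).val.1.map f, (halve l).val.2.map f) := by
  induction l with
  | nil => simp [halve]
  | cons a as ih => simp [halve, ih]

theorem merge_perm (le : α → α → Timed Bool) (as bs : List α) :
    (merge le as bs).val.Perm (as ++ bs) := by
  fun_induction merge le as bs with
  | case1 bs => simp
  | case2 a as => simp
  | case3 a as b bs c h rest ih => simpa [rest] using ih
  | case4 a as b bs c h rest ih =>
    simp only [rest]
    exact (List.Perm.cons b ih).trans List.perm_middle.symm

theorem merge_time_le {le : α → α → Timed Bool} {c : ℕ} {as bs : List α}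
    (h : ∀ a ∈ as, ∀ b ∈ bs, (le a b).time ≤ c) :
    (merge le as bs).time ≤ (c + 1) * (as.length + bs.length) + 1 := by
  fun_induction merge le as bs with
  | case1 bs => simp
  | case2 a as => simp
  | case3 a as b bs c' hc rest ih =>
    have h1 := ih fun x hx => h x (List.mem_cons_of_mem _ hx)
    have h2 := h a List.mem_cons_self b List.mem_cons_self
    simp only [List.length_cons, rest, c'] at h1 ⊢
    nlinarith
  | case4 a as b bs c' hc rest ih =>
    have h1 := ih fun x hx y hy => h x hx y (List.mem_cons_of_mem _ hy)
    have h2 := h a List.mem_cons_self b List.mem_cons_self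
    simp only [List.length_cons, rest, c'] at h1 ⊢
    nlinarith

theorem merge_pairwise {le : α → α → Timed Bool}
    (htrans : ∀ a b c, (le a b).val → (le b c).val → (le a c).val)
    (htotal : ∀ a b, (le a b).val ∨ (le b a).val) {as bs : List α}
    (has : as.Pairwise fun a b => (le a b).val) (hbs : bs.Pairwise fun a b => (le a b).val) :
    (merge le as bs).val.Pairwise fun a b => (le a b).val := by
  fun_induction merge le as bs with
  | case1 bs => exact hbs
  | case2 a as => exact has
  | case3 a as b bs c hc rest ih =>
    refine List.pairwise_cons.2 ⟨fun x hx => ?_, ih (List.pairwise_cons.1 has).2 hbs⟩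
    rcases List.mem_append.1 ((merge_perm le as (b :: bs)).subset hx) with hx | hx
    · exact (List.pairwise_cons.1 has).1 x hx
    · rcases List.mem_cons.1 hx with rfl | hx
      · exact hc
      · exact htrans _ _ _ hc ((List.pairwise_cons.1 hbs).1 x hx)
  | case4 a as b bs c hc rest ih =>
    refine List.pairwise_cons.2 ⟨fun x hx => ?_, ih has (List.pairwise_cons.1 hbs).2⟩
    have hba : (le b a).val := (htotal a b).resolve_left hc
    rcases List.mem_append.1 ((merge_perm le (a :: as) bs).subset hx) with hx | hx
    · rcases List.mem_cons.1 hx with rfl | hx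
      · exact hba
      · exact htrans _ _ _ hba ((List.pairwise_cons.1 has).1 x hx)
    · exact (List.pairwise_cons.1 hbs).1 x hx

/-- Merging looks only at the answers of the comparisons, never at their durations, so it commutes
with any map that preserves the answers. This lets the keys be stripped from the sorted pairs later.
-/
theorem merge_map {le : α → α → Timed Bool} {le' : β → β → Timed Bool} {f : α → β}
    (h : ∀ a b, (le' (f a) (f b)).val = (le a b).val) (as bs : List α) :
    (merge le' (as.map f) (bs.map f)).val = (merge le as bs).val.map f := by
  fun_induction merge le as bs with
  | case1 bs => simp [merge]
  | case2 a as => simp [merge]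
  | case3 a as b bs c hc rest ih =>
    simp only [List.map_cons] at ih ⊢
    rw [merge]
    simp [h, show (le a b).val = true from hc, ih, rest]
  | case4 a as b bs c hc rest ih =>
    simp only [List.map_cons] at ih ⊢
    rw [merge]
    simp [h, show (le a b).val = false by simpa [c] using hc, ih, rest]

theorem mergeSort_perm (le : α → α → Timed Bool) (l : List α) : (mergeSort le l).val.Perm l := by
  fun_induction mergeSort le l with
  | case1 => simp
  | case2 a => simp
  | case3 a b as s l r m ih1 ih2 =>
    exact ((merge_perm le _ _).trans (ih1.append ih2)).trans (halve_perm _)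

theorem mergeSort_pairwise {le : α → α → Timed Bool}
    (htrans : ∀ a b c, (le a b).val → (le b c).val → (le a c).val)
    (htotal : ∀ a b, (le a b).val ∨ (le b a).val) (l : List α) :
    (mergeSort le l).val.Pairwise fun a b => (le a b).val := by
  fun_induction mergeSort le l with
  | case1 => simp
  | case2 a => simp
  | case3 a b as s l r m ih1 ih2 => exact merge_pairwise htrans htotal ih1 ih2

theorem mergeSort_map {le : α → α → Timed Bool} {le' : β → β → Timed Bool} {f : α → β}
    (h : ∀ a b, (le' (f a) (f b)).val = (le a b).val) (l : List α) :
    (mergeSort le' (l.map f)).val = (mergeSort le l).val.map f := by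
  fun_induction mergeSort le l with
  | case1 => simp [mergeSort]
  | case2 a => simp [mergeSort]
  | case3 a b as s l r m ih1 ih2 =>
    have hs := halve_map f (a :: b :: as)
    simp only [List.map_cons] at hs ⊢
    rw [mergeSort]
    simp only [hs]
    rw [← merge_map h, ← ih1, ← ih2]

theorem mergeSort_time_le {le : α → α → Timed Bool} {c : ℕ} {l : List α}
    (h : ∀ a ∈ l, ∀ b ∈ l, (le a b).time ≤ c) (hl : l ≠ []) :
    (mergeSort le l).time ≤ (c + 4) * l.length * (Nat.clog 2 l.length + 1) := by
  fun_induction mergeSort le l with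
  | case1 => simp at hl
  | case2 a => simp
  | case3 a b as s l r m ih1 ih2 =>
    obtain ⟨hs1, hs2⟩ := halve_length (a :: b :: as)
    have hp := halve_perm (a :: b :: as)
    have hm1 : ∀ x ∈ s.val.1, x ∈ a :: b :: as := fun x hx =>
      hp.subset (List.mem_append_left _ hx)
    have hm2 : ∀ x ∈ s.val.2, x ∈ a :: b :: as := fun x hx =>
      hp.subset (List.mem_append_right _ hx)
    have l1 : l.val.length = s.val.1.length := (mergeSort_perm le _).length_eq
    have l2 : r.val.length = s.val.2.length := (mergeSort_perm le _).length_eq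
    have t1 := ih1 (fun x hx y hy => h x (hm1 x hx) y (hm1 y hy))
      (by rw [← List.length_pos_iff, hs1]; simp)
    have t2 := ih2 (fun x hx y hy => h x (hm2 x hx) y (hm2 y hy))
      (by rw [← List.length_pos_iff, hs2]; simp)
    have t3 : m.time ≤ (c + 1) * (l.val.length + r.val.length) + 1 := by
      refine merge_time_le fun x hx y hy => ?_
      exact h x (hm1 x ((mergeSort_perm le _).subset hx)) y
        (hm2 y ((mergeSort_perm le _).subset hy))
    have t4 : s.time = (a :: b :: as).length + 1 := halve_time _
    have hN : 2 ≤ (a :: b :: as).length := by simp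
    generalize (a :: b :: as).length = N at *
    -- The larger half governs the recursion depth, and `Nat.clog` drops by exactly one on it.
    have hc1 : Nat.clog 2 N = Nat.clog 2 ((N + 1) / 2) + 1 := by
      rw [Nat.clog_of_two_le (by norm_num) hN]; rfl
    have hc2 : Nat.clog 2 (N / 2) ≤ Nat.clog 2 ((N + 1) / 2) :=
      Nat.clog_mono_right _ (by omega)
    have hsum : (N + 1) / 2 + N / 2 = N := by omega
    have e1 : s.val.1.length = (N + 1) / 2 := hs1
    have e2 : s.val.2.length = N / 2 := hs2
    rw [l1, l2, e1, e2, hsum] at t3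
    rw [e1] at t1
    rw [e2] at t2
    rw [hc1]
    generalize Nat.clog 2 ((N + 1) / 2) = K at *
    have t2' : r.time ≤ (c + 4) * (N / 2) * (K + 1) := t2.trans (by gcongr)
    have t12 : l.time + r.time ≤ (c + 4) * N * (K + 1) := by
      calc _ ≤ (c + 4) * ((N + 1) / 2) * (K + 1) + (c + 4) * (N / 2) * (K + 1) :=
            add_le_add t1 t2'
        _ = (c + 4) * ((N + 1) / 2 + N / 2) * (K + 1) := by ring
        _ = _ := by rw [hsum]
    -- Splitting and merging at this level cost at most `(c + 2) * N + 3`, which is below `(c + 4) *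
    -- N` because `N ≥ 2`.
    have : (c + 4) * N * (K + 1 + 1) = (c + 4) * N * (K + 1) + (c + 4) * N := by ring
    rw [this, t4]
    nlinarith

end Timed

theorem List.take_le_take {U : Type*} [LinearOrder U] (m : ℕ) {as bs : List U} (h : as ≤ bs) :
    as.take m ≤ bs.take m := by
  simp only [← not_lt] at h ⊢
  induction m generalizing as bs with
  | zero => simp
  | succ m ih =>
    cases as with
    | nil => simp
    | cons a as =>
      cases bs with
      | nil => simp at h
      | cons b bs =>
        simp only [List.take_succ_cons, List.cons_lt_cons_iff, not_or, not_and] at h ⊢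
        exact ⟨h.1, fun hab => ih (h.2 hab)⟩

/-! ### Sorting points by hash values, and contiguity of collision classes -/

section Sorting

variable {Ω P U : Type*} {M : ℕ}

/-- The sequence of hash values of a point. -/
def hashValues (h : Ω → P → U) (ω : Fin M → Ω) (x : P) : List U :=
  (List.finRange M).map fun j => h (ω j) x

/-- The points that agree with `p` in the first `ℓ` hash values. -/
def collisionClass (h : Ω → P → U) (ℓ : ℕ) (p : P) (ω : Fin M → Ω) : Set P :=
  {x | ∀ j : Fin M, (j : ℕ) < ℓ → h (ω j) p = h (ω j) x}

theorem self_mem_collisionClass (h : Ω → P → U) (ℓ : ℕ) (p : P) (ω : Fin M → Ω) :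
    p ∈ collisionClass h ℓ p ω := fun _ _ => rfl

theorem mem_collisionClass_iff_take {h : Ω → P → U} {ℓ : ℕ} {p x : P} {ω : Fin M → Ω} :
    x ∈ collisionClass h ℓ p ω ↔ (hashValues h ω p).take ℓ = (hashValues h ω x).take ℓ := by
  rw [hashValues, hashValues, ← List.map_take, ← List.map_take, List.map_inj_left]
  refine forall_congr' fun j => imp_congr ?_ Iff.rfl
  rw [List.mem_take_iff_getElem]
  constructor
  · intro hj
    exact ⟨j, by simpa using hj, by simp⟩
  · rintro ⟨i, hi, rfl⟩
    simp only [List.length_finRange, lt_min_iff] at hi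
    simpa using hi.1

theorem hashKey_val (h : Ω → P → U) (timeH : Ω → P → ℕ) (ω : Fin M → Ω) (x : P) :
    (hashKey h timeH ω x).val = (hashValues h ω x, x) := by
  simp [hashKey, hashValues]

theorem hashKey_time_le {h : Ω → P → U} {timeH : Ω → P → ℕ} {T : ℕ}
    (hT : ∀ ω x, timeH ω x ≤ T) (ω : Fin M → Ω) (x : P) :
    (hashKey h timeH ω x).time ≤ (T + 1) * M + 2 := by
  have := Timed.map_time_le (f := fun j => (⟨h (ω j) x, timeH (ω j) x⟩ : Timed U))
    (l := List.finRange M) (c := T) fun j _ => hT _ _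
  rw [List.length_finRange] at this
  simp only [hashKey, Timed.bind_time]
  omega

variable [LinearOrder U]

/-- The order depends on the hash values only through the table of pairwise comparisons of keys. For
finite `P` that table has finitely many values, which is what makes the sorted list measurable. -/
theorem sortedPoints_val (h : Ω → P → U) (timeH : Ω → P → ℕ) (ω : Fin M → Ω) (pts : List P) :
    (sortedPoints h timeH ω pts).val =
      (Timed.mergeSort (fun x y => ⟨decide (hashValues h ω x ≤ hashValues h ω y), 0⟩) pts).val := by
  simp only [sortedPoints, Timed.bind_val, Timed.map_val, hashKey_val]
  rw [Timed.mergeSort_map (f := fun x => (hashValues h ω x, x))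
    (le := fun x y => ⟨decide (hashValues h ω x ≤ hashValues h ω y), 0⟩)
    (fun a b => Timed.lexLE_val _ _), List.map_map]
  simp [Function.comp_def]

theorem sortedPoints_perm (h : Ω → P → U) (timeH : Ω → P → ℕ) (ω : Fin M → Ω) (pts : List P) :
    (sortedPoints h timeH ω pts).val.Perm pts := by
  rw [sortedPoints_val]
  exact Timed.mergeSort_perm _ _

theorem sortedPoints_pairwise (h : Ω → P → U) (timeH : Ω → P → ℕ) (ω : Fin M → Ω) (pts : List P) :
    (sortedPoints h timeH ω pts).val.Pairwise fun x y => hashValues h ω x ≤ hashValues h ω y := by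
  rw [sortedPoints_val]
  have := Timed.mergeSort_pairwise
    (le := fun x y => (⟨decide (hashValues h ω x ≤ hashValues h ω y), 0⟩ : Timed Bool))
    (fun a b c => by simpa using fun h₁ h₂ => h₁.trans h₂) (fun a b => by simpa using le_total (hashValues h ω a) _) pts
  simpa using this

/-- A collision class is contiguous in the sorted list. -/
theorem mem_collisionClass_of_between {h : Ω → P → U} {timeH : Ω → P → ℕ} {ω : Fin M → Ω}
    {pts : List P} {ℓ : ℕ} {p x y z : P} {a b c : ℕ}
    (hx : (sortedPoints h timeH ω pts).val[a]? = some x)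
    (hy : (sortedPoints h timeH ω pts).val[b]? = some y)
    (hz : (sortedPoints h timeH ω pts).val[c]? = some z) (hab : a ≤ b) (hbc : b ≤ c)
    (hxC : x ∈ collisionClass h ℓ p ω) (hzC : z ∈ collisionClass h ℓ p ω) :
    y ∈ collisionClass h ℓ p ω := by
  have mono : ∀ {i j : ℕ} {u v : P}, (sortedPoints h timeH ω pts).val[i]? = some u →
      (sortedPoints h timeH ω pts).val[j]? = some v → i ≤ j →
      hashValues h ω u ≤ hashValues h ω v := by
    intro i j u v hu hv hij
    obtain ⟨hi, rfl⟩ := List.getElem?_eq_some_iff.1 hu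
    obtain ⟨hj, rfl⟩ := List.getElem?_eq_some_iff.1 hv
    rcases hij.eq_or_lt with rfl | hlt
    · exact le_rfl
    · exact List.pairwise_iff_getElem.1 (sortedPoints_pairwise h timeH ω pts) i j hi hj hlt
  -- The prefixes of `x` and `z` both equal that of `p`, and the prefix of `y` is squeezed between
  -- them.
  rw [mem_collisionClass_iff_take] at *
  refine le_antisymm ?_ ?_
  · rw [hxC]; exact List.take_le_take ℓ (mono hx hy hab)
  · rw [hzC]; exact List.take_le_take ℓ (mono hy hz hbc)

theorem sortedPoints_time_le {h : Ω → P → U} {timeH : Ω → P → ℕ} {T : ℕ}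
    (hT : ∀ ω x, timeH ω x ≤ T) (ω : Fin M → Ω) {pts : List P} (hpts : pts ≠ []) :
    (sortedPoints h timeH ω pts).time ≤
      ((T + 1) * M + 5) * pts.length + 2 +
        (M + 5) * pts.length * (Nat.clog 2 pts.length + 1) := by
  simp only [sortedPoints, Timed.bind_time]
  have h1 := Timed.map_time_le (f := hashKey h timeH ω) (l := pts) (c := (T + 1) * M + 2)
    fun x _ => hashKey_time_le hT ω x
  have hval : (Timed.map (hashKey h timeH ω) pts).val = pts.map fun x => (hashValues h ω x, x) := by
    simp [hashKey_val]
  have h2 := Timed.mergeSort_time_le (le := fun a b : List U × P => Timed.lexLE a.1 b.1)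
    (c := M + 1) (l := (Timed.map (hashKey h timeH ω) pts).val) (by
      rw [hval]
      intro a ha b _
      obtain ⟨x, _, rfl⟩ := List.mem_map.1 ha
      exact (Timed.lexLE_time_le _ _).trans (by simp [hashValues])) (by simpa [hval] using hpts)
  have hlen : (Timed.map (hashKey h timeH ω) pts).val.length = pts.length := by simp
  have h3 := Timed.map_time_le (f := fun a : List U × P => (⟨a.2, 1⟩ : Timed P))
    (l := (Timed.mergeSort (fun a b => Timed.lexLE a.1 b.1)
      (Timed.map (hashKey h timeH ω) pts).val).val) (c := 1) fun _ _ => le_rfl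
  rw [(Timed.mergeSort_perm _ _).length_eq, hlen] at h3
  rw [hlen] at h2
  have e : (M + 1 + 4) = M + 5 := rfl
  rw [e] at h2
  nlinarith

end Sorting

/-! ### Edges created in a block, in a repetition and in total, with their cost -/

section Edges

variable {Ω P U : Type*}

theorem leaderEdges_eq (μ : P → P → ℝ) (s : ℕ) (leader : (t m : ℕ) → Fin (m + 1)) (B : List P) :
    leaderEdges μ s leader B = (⟨B.length, B.length + 1⟩ : Timed ℕ).bind fun len =>
      Timed.flatMap
        (fun _ t => (Timed.nth B (leader t (len - 1))).bind fun o =>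
          match o with
          | none => ⟨[], 1⟩
          | some y => Timed.map (fun x => ⟨(x, y, μ x y), 1⟩) B)
        0 (List.range s) := by
  have : Timed.length B = ⟨B.length, B.length + 1⟩ := by
    rw [← Timed.length_time B]
    rw [← Timed.length_val B]
  rw [leaderEdges, this]

theorem leaderEdges_length_le (μ : P → P → ℝ) (s : ℕ) (leader : (t m : ℕ) → Fin (m + 1))
    (B : List P) : (leaderEdges μ s leader B).val.length ≤ s * B.length := by
  rw [leaderEdges_eq]
  refine (Timed.flatMap_length_le (g := fun _ => B.length) (fun _ t _ => ?_) 0).trans (by simp)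
  simp only [Timed.bind_val, Timed.nth_val]
  split <;> simp

theorem leaderEdges_time_le (μ : P → P → ℝ) (s : ℕ) (leader : (t m : ℕ) → Fin (m + 1))
    (B : List P) : (leaderEdges μ s leader B).time ≤ s * (4 * B.length + 3) + B.length + 2 := by
  rw [leaderEdges_eq, Timed.bind_time]
  dsimp only
  have := Timed.flatMap_time_le (l := List.range s) (g := fun _ => 4 * B.length + 3)
    (f := fun _ t => (Timed.nth B (leader t (B.length - 1))).bind fun o =>
        match o with
        | none => ⟨[], 1⟩
        | some y => Timed.map (fun x => (⟨(x, y, μ x y), 1⟩ : Timed (P × P × ℝ))) B)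
    (fun _ t _ => by
      have h1 := Timed.nth_time_le B (leader t (B.length - 1))
      simp only [Timed.bind_time, Timed.bind_val, Timed.nth_val]
      split
      · simp; omega
      · rename_i y _
        have h2 := Timed.map_time_le (f := fun x => (⟨(x, y, μ x y), 1⟩ : Timed (P × P × ℝ)))
          (l := B) (c := 1) fun _ _ => le_rfl
        simp only [Timed.map_val, List.length_map]
        omega) 0
  simp only [List.map_const', List.length_range, List.sum_replicate, smul_eq_mul] at this
  omega

theorem mem_leaderEdges {μ : P → P → ℝ} {s : ℕ} {leader : (t m : ℕ) → Fin (m + 1)} {B : List P}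
    {t : ℕ} {x y : P} (ht : t < s) (hy : B[(leader t (B.length - 1) : ℕ)]? = some y)
    (hx : x ∈ B) : (x, y, μ x y) ∈ (leaderEdges μ s leader B).val := by
  rw [leaderEdges_eq]
  refine Timed.mem_flatMap.2 ⟨t, t, by simp [ht], ?_⟩
  rw [Timed.bind_val, Timed.nth_val, hy]
  simpa using hx

theorem allPairsEdges_length_le (μ : P → P → ℝ) (B : List P) :
    (allPairsEdges μ B).val.length ≤ B.length * B.length := by
  refine (Timed.flatMap_length_le (g := fun _ => B.length) (fun _ t _ => ?_) 0).trans (by simp)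
  simp

theorem allPairsEdges_time_le (μ : P → P → ℝ) (B : List P) :
    (allPairsEdges μ B).time ≤ B.length * (3 * B.length + 2) + 1 := by
  refine (Timed.flatMap_time_le (g := fun _ => 3 * B.length + 2) (fun _ y _ => ?_) 0).trans
    (by simp)
  have h2 := Timed.map_time_le (f := fun x => (⟨(x, y, μ x y), 1⟩ : Timed (P × P × ℝ)))
    (l := B) (c := 1) fun _ _ => le_rfl
  simp only [Timed.map_val, List.length_map]
  omega

theorem mem_allPairsEdges {μ : P → P → ℝ} {B : List P} {x y : P} (hx : x ∈ B) (hy : y ∈ B) :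
    (x, y, μ x y) ∈ (allPairsEdges μ B).val := by
  obtain ⟨i, hi⟩ := List.mem_iff_getElem?.1 hy
  refine Timed.mem_flatMap.2 ⟨i, y, hi, by simpa using hx⟩

variable [LinearOrder U] {μ : P → P → ℝ} {h : Ω → P → U} {timeH : Ω → P → ℕ} {k M : ℕ} {ρ : ℝ}
  {s : ℕ} {pts : List P}

theorem mem_starsRep_of_leader {τ : RepTape Ω k M} (hk : (pts.length : ℝ) ^ (2 * ρ) < k)
    {j t : ℕ} {B : List P} {x y : P}
    (hB : (Timed.blocks (16 * k) (8 * k + τ.2.1) (sortedPoints h timeH τ.1 pts).val).val[j]? =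
      some B) (ht : t < s) (hy : B[(τ.2.2 (j, t, B.length - 1) : ℕ)]? = some y) (hx : x ∈ B) :
    (x, y, μ x y) ∈ (starsRep μ h timeH k M ρ s pts τ).val := by
  simp only [starsRep, Timed.bind_val, if_pos hk]
  refine Timed.mem_flatMap.2 ⟨j, B, hB, ?_⟩
  refine mem_leaderEdges ht ?_ hx
  rw [zero_add]
  exact hy

theorem mem_starsRep_of_allPairs {τ : RepTape Ω k M} (hk : ¬ (pts.length : ℝ) ^ (2 * ρ) < k)
    {j : ℕ} {B : List P} {x y : P}
    (hB : (Timed.blocks (16 * k) (8 * k + τ.2.1) (sortedPoints h timeH τ.1 pts).val).val[j]? =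
      some B) (hx : x ∈ B) (hy : y ∈ B) :
    (x, y, μ x y) ∈ (starsRep μ h timeH k M ρ s pts τ).val := by
  simp only [starsRep, Timed.bind_val, if_neg hk]
  exact Timed.mem_flatMap.2 ⟨j, B, hB, mem_allPairsEdges hx hy⟩

theorem mem_stars {R : ℕ} {τ : Fin R → RepTape Ω k M} {i : Fin R} {e : P × P × ℝ}
    (he : e ∈ (starsRep μ h timeH k M ρ s pts (τ i)).val) :
    e ∈ (stars μ h timeH k M ρ s R pts τ).val :=
  Timed.mem_flatMap.2 ⟨i, i, by simp, he⟩

theorem List.sum_map_length_flatten {α : Type*} (L : List (List α)) :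
    (L.map List.length).sum = L.flatten.length := by
  simp [List.length_flatten]

theorem shift_le (i : Fin (8 * k + 1)) : 8 * k + (i : ℕ) ≤ 16 * k := by omega

/-- `E` bounds the number of edges charged to each point, in whichever branch is taken. The blocks
partition the points, so the charges add up to `E` times their number. -/
theorem starsRep_length_le (hk : 1 ≤ k) (τ : RepTape Ω k M) {E : ℕ}
    (h1 : (pts.length : ℝ) ^ (2 * ρ) < k → s ≤ E)
    (h2 : ¬ (pts.length : ℝ) ^ (2 * ρ) < k → 16 * k ≤ E) :
    (starsRep μ h timeH k M ρ s pts τ).val.length ≤ E * pts.length := by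
  have hsum : ((Timed.blocks (16 * k) (8 * k + τ.2.1)
      (sortedPoints h timeH τ.1 pts).val).val.map List.length).sum = pts.length := by
    rw [List.sum_map_length_flatten, Timed.blocks_flatten,
      (sortedPoints_perm h timeH τ.1 pts).length_eq]
  rw [← hsum, ← List.sum_map_mul_left]
  simp only [starsRep, Timed.bind_val]
  split_ifs with hc
  · refine Timed.flatMap_length_le (fun j B _ => (leaderEdges_length_le _ _ _ _).trans ?_) 0
    exact Nat.mul_le_mul_right _ (h1 hc)
  · refine Timed.flatMap_length_le (fun j B hB => (allPairsEdges_length_le _ _).trans ?_) 0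
    exact Nat.mul_le_mul_right _
      ((Timed.blocks_length_le (by omega) (shift_le _) _ B hB).trans (h2 hc))

theorem starsRep_time_le {T : ℕ} (hT : ∀ ω x, timeH ω x ≤ T) (hpts : pts ≠ []) (hk : 1 ≤ k)
    (τ : RepTape Ω k M) {E : ℕ} (hE : 1 ≤ E)
    (h1 : (pts.length : ℝ) ^ (2 * ρ) < k → s ≤ E)
    (h2 : ¬ (pts.length : ℝ) ^ (2 * ρ) < k → 16 * k ≤ E) :
    (starsRep μ h timeH k M ρ s pts τ).time ≤ M + 8 +
      ((T + 1) * M + 7) * pts.length +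
        (M + 5) * pts.length * (Nat.clog 2 pts.length + 1) + E * (17 * pts.length + 6) := by
  have hlen := (sortedPoints_perm h timeH τ.1 pts).length_eq
  have hsum : ((Timed.blocks (16 * k) (8 * k + τ.2.1)
      (sortedPoints h timeH τ.1 pts).val).val.map List.length).sum = pts.length := by
    rw [List.sum_map_length_flatten, Timed.blocks_flatten, hlen]
  have hblocks := Timed.length_blocks_le (16 * k) (8 * k + τ.2.1)
    (sortedPoints h timeH τ.1 pts).val
  have hs := sortedPoints_time_le (M := M) (h := h) hT τ.1 hpts
  have hb := Timed.blocks_time_le (16 * k) (8 * k + τ.2.1) (sortedPoints h timeH τ.1 pts).val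
  rw [hlen] at hb hblocks
  have hbl := Timed.blocks_length_le (W := 16 * k) (by omega) (shift_le τ.2.1)
    (sortedPoints h timeH τ.1 pts).val
  simp only [starsRep, Timed.bind_time]
  generalize hBs : (Timed.blocks (16 * k) (8 * k + τ.2.1)
    (sortedPoints h timeH τ.1 pts).val).val = Bs at *
  have key : ((if (pts.length : ℝ) ^ (2 * ρ) < k then
        Timed.flatMap (fun j B => leaderEdges μ s (fun t m => τ.2.2 (j, t, m)) B) 0 Bs
      else Timed.flatMap (fun _ B => allPairsEdges μ B) 0 Bs) : Timed _).time ≤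
        (Bs.map fun B => E * (11 * B.length + 6)).sum + 1 := by
    split_ifs with hc
    · refine Timed.flatMap_time_le (fun j B _ => ?_) 0
      have e1 := leaderEdges_time_le μ s (fun t m => τ.2.2 (j, t, m)) B
      have e2 := leaderEdges_length_le μ s (fun t m => τ.2.2 (j, t, m)) B
      have e3 := h1 hc
      calc _ ≤ s * (4 * B.length + 3) + B.length + 2 + s * B.length + 1 := by omega
        _ ≤ E * (4 * B.length + 3) + E * B.length + 2 * E + E * B.length + E := by
          have := Nat.le_mul_of_pos_left B.length hE
          have := Nat.mul_le_mul_right B.length e3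
          have := Nat.mul_le_mul_right (4 * B.length + 3) e3
          omega
        _ ≤ _ := by nlinarith [Nat.zero_le (E * B.length)]
    · refine Timed.flatMap_time_le (fun j B hB => ?_) 0
      have e1 := allPairsEdges_time_le μ B
      have e2 := allPairsEdges_length_le μ B
      have e3 : B.length ≤ E := (hbl B hB).trans (h2 hc)
      have e4 := Nat.mul_le_mul_right B.length e3
      have e5 := Nat.le_mul_of_pos_left B.length hE
      nlinarith
  have e : (Bs.map fun B => E * (11 * B.length + 6)).sum =
      E * (11 * pts.length + 6 * Bs.length) := by
    rw [List.sum_map_mul_left, List.sum_map_add, List.sum_map_mul_left, hsum]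
    simp [mul_comm]
  rw [e] at key
  -- There are at most `pts.length + 1` blocks.
  have e' : E * (11 * pts.length + 6 * Bs.length) ≤ E * (17 * pts.length + 6) :=
    Nat.mul_le_mul_left _ (by omega)
  have : ((T + 1) * M + 7) * pts.length = ((T + 1) * M + 5) * pts.length + 2 * pts.length := by
    ring
  omega

theorem stars_length_le {R L : ℕ} {τ : Fin R → RepTape Ω k M}
    (hL : ∀ i, (starsRep μ h timeH k M ρ s pts (τ i)).val.length ≤ L) :
    (stars μ h timeH k M ρ s R pts τ).val.length ≤ R * L := by
  refine (Timed.flatMap_length_le (g := fun _ => L) (fun _ i _ => hL i) 0).trans (by simp)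

theorem stars_time_le {R L D : ℕ} {τ : Fin R → RepTape Ω k M}
    (hL : ∀ i, (starsRep μ h timeH k M ρ s pts (τ i)).val.length ≤ L)
    (hD : ∀ i, (starsRep μ h timeH k M ρ s pts (τ i)).time ≤ D) :
    (stars μ h timeH k M ρ s R pts τ).time ≤ R * (D + L + 1) + 1 := by
  refine (Timed.flatMap_time_le (g := fun _ => D + L + 1) (fun _ i _ => ?_) 0).trans (by simp)
  have := hL i
  have := hD i
  omega

theorem edgeListGraph_ncard_le (es : List (P × P × ℝ)) :
    (edgeListGraph es).edgeSet.ncard ≤ es.length := by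
  classical
  have hsub : (edgeListGraph es).edgeSet ⊆
      ((es.map fun e => s(e.1, e.2.1)).toFinset : Set (Sym2 P)) := by
    intro e
    induction e with
    | _ x y =>
      simp only [SimpleGraph.mem_edgeSet, edgeListGraph, SimpleGraph.fromRel_adj]
      rintro ⟨_, ⟨w, hw⟩ | ⟨w, hw⟩⟩
      · simp only [Finset.mem_coe, List.mem_toFinset, List.mem_map]
        exact ⟨_, hw, rfl⟩
      · simp only [Finset.mem_coe, List.mem_toFinset, List.mem_map]
        exact ⟨_, hw, Sym2.eq_swap⟩
  refine (Set.ncard_le_ncard hsub (Finset.finite_toSet _)).trans ?_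
  rw [Set.ncard_coe_finset]
  exact (List.toFinset_card_le _).trans (by simp)

end Edges

/-! ### Random shifts and the block containing a point -/

section Shift

/-- The index of the block that contains position `q`, for the shift `8 * k + i`. -/
def blockIdx (k i q : ℕ) : ℕ := (q + 16 * k - (8 * k + i)) / (16 * k)

open Classical in
/-- The shifts for which the positions at distance at most `k` from `q` lie in one block. -/
noncomputable def goodShifts (k q : ℕ) : Finset (Fin (8 * k + 1)) :=
  Finset.univ.filter fun i => ∀ q', q ≤ q' + k → q' ≤ q + k → blockIdx k i q' = blockIdx k i q

theorem exists_cut_of_blockIdx_ne {k i u v : ℕ} (hk : 1 ≤ k) (hi : i ≤ 8 * k) (huv : u ≤ v)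
    (h : blockIdx k i u ≠ blockIdx k i v) : ∃ b, u < b ∧ b ≤ v ∧ (b + 8 * k) % (16 * k) = i := by
  have hle : blockIdx k i u ≤ blockIdx k i v := Nat.div_le_div_right (by omega)
  have hlt := lt_of_le_of_ne hle h
  unfold blockIdx at hlt
  have h1 : u + 16 * k - (8 * k + i) < (v + 16 * k - (8 * k + i)) / (16 * k) * (16 * k) :=
    (Nat.div_lt_iff_lt_mul (by omega)).1 hlt
  have h2 := Nat.div_mul_le_self (v + 16 * k - (8 * k + i)) (16 * k)
  have h3 : 1 ≤ (v + 16 * k - (8 * k + i)) / (16 * k) := by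
    generalize (v + 16 * k - (8 * k + i)) / (16 * k) = D at *
    exact Nat.one_le_iff_ne_zero.2 (Nat.ne_zero_of_lt hlt)
  generalize (v + 16 * k - (8 * k + i)) / (16 * k) = D at *
  have h4 := Nat.le_mul_of_pos_left (16 * k) h3
  -- The cut is the first position of the block with index `D`, the block of `v`.
  refine ⟨D * (16 * k) + i - 8 * k, by omega, by omega, ?_⟩
  rw [show D * (16 * k) + i - 8 * k + 8 * k = i + D * (16 * k) by omega, Nat.add_mul_mod_self_right,
    Nat.mod_eq_of_lt (by omega)]

/-- A bad shift places a cut at one of the at most `2 * k` positions in `(q - k, q + k]`, and the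
position of the cut determines the shift modulo `16 * k`. So at most `2 * k` of the `8 * k + 1`
shifts are bad. -/
theorem card_le_two_mul_card_goodShifts {k : ℕ} (hk : 1 ≤ k) (q : ℕ) :
    8 * k + 1 ≤ 2 * (goodShifts k q).card := by
  classical
  have hsub : (goodShifts k q)ᶜ.map Fin.valEmbedding ⊆
      (Finset.Ioc (q - k) (q + k)).image fun b => (b + 8 * k) % (16 * k) := by
    intro i' hi'
    obtain ⟨i, hi, rfl⟩ := Finset.mem_map.1 hi'
    simp only [goodShifts, Finset.mem_compl, Finset.mem_filter, Finset.mem_univ, true_and,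
      not_forall] at hi
    obtain ⟨q', h1, h2, hne⟩ := hi
    simp only [Finset.mem_image, Finset.mem_Ioc, Fin.valEmbedding_apply]
    rcases le_total q q' with hq | hq
    · obtain ⟨b, hb1, hb2, hb⟩ := exists_cut_of_blockIdx_ne hk (by omega) hq (Ne.symm hne)
      exact ⟨b, by omega, hb⟩
    · obtain ⟨b, hb1, hb2, hb⟩ := exists_cut_of_blockIdx_ne hk (by omega) hq hne
      exact ⟨b, by omega, hb⟩
  have h1 := (Finset.card_le_card hsub).trans Finset.card_image_le
  rw [Finset.card_map, Finset.card_compl, Fintype.card_fin, Nat.card_Ioc] at h1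
  omega

open Classical in
/-- The block that contains `p`, for the shift `8 * k + i`. -/
noncomputable def blockOf {P : Type*} (k i : ℕ) (l : List P) (p : P) : List P :=
  ((Timed.blocks (16 * k) (8 * k + i) l).val[blockIdx k i (l.idxOf p)]?).getD []

open Classical in
theorem blockOf_spec {P : Type*} {k i : ℕ} (hk : 1 ≤ k) (hi : i ≤ 8 * k) {l : List P} {p : P}
    (hp : p ∈ l) :
    (Timed.blocks (16 * k) (8 * k + i) l).val[blockIdx k i (l.idxOf p)]? = some (blockOf k i l p) ∧
      ∀ q x, blockIdx k i q = blockIdx k i (l.idxOf p) → l[q]? = some x → x ∈ blockOf k i l p := by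
  obtain ⟨B, hB, hmem⟩ := Timed.mem_block_of_index (W := 16 * k) (r := 8 * k + i) (by omega)
    (by omega) l (List.idxOf_lt_length_of_mem hp)
  have : blockOf k i l p = B := by
    unfold blockOf blockIdx
    rw [hB]; rfl
  rw [this]
  exact ⟨hB, hmem⟩

open Classical in
theorem self_mem_blockOf {P : Type*} {k i : ℕ} (hk : 1 ≤ k) (hi : i ≤ 8 * k) {l : List P} {p : P}
    (hp : p ∈ l) : p ∈ blockOf k i l p :=
  (blockOf_spec hk hi hp).2 _ p rfl (List.getElem?_idxOf hp)

theorem blockOf_length_le {P : Type*} {k i : ℕ} (hk : 1 ≤ k) (hi : i ≤ 8 * k) {l : List P} {p : P}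
    (hp : p ∈ l) : (blockOf k i l p).length ≤ 16 * k :=
  Timed.blocks_length_le (by omega) (by omega) l _ (List.mem_of_getElem? (blockOf_spec hk hi hp).1)

open Classical in
/-- For a good shift, the block of `p` contains every element of a contiguous set around `p`, or
at least `k` of them. -/
theorem mem_blockOf_or_le_ncard {P : Type*} {k : ℕ} (hk : 1 ≤ k) {l : List P} (hl : l.Nodup)
    {p x : P} (hp : p ∈ l) (hx : x ∈ l) {C : Set P}
    (hC : ∀ {a b c : ℕ} {u v w : P}, l[a]? = some u → l[b]? = some v → l[c]? = some w →
      a ≤ b → b ≤ c → u ∈ C → w ∈ C → v ∈ C) (hpC : p ∈ C) (hxC : x ∈ C)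
    {i : Fin (8 * k + 1)} (hi : i ∈ goodShifts k (l.idxOf p)) :
    x ∈ blockOf k i l p ∨ k ≤ {y | y ∈ blockOf k i l p ∧ y ∈ C}.ncard := by
  have hspec := (blockOf_spec hk (by omega : (i : ℕ) ≤ 8 * k) hp).2
  simp only [goodShifts, Finset.mem_filter, Finset.mem_univ, true_and] at hi
  have hlp := List.getElem?_idxOf hp
  have hlx := List.getElem?_idxOf hx
  have hxlt := List.idxOf_lt_length_of_mem hx
  have hplt := List.idxOf_lt_length_of_mem hp
  generalize hq : l.idxOf p = q at *
  generalize hqx : l.idxOf x = r at *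
  by_cases hwin : q ≤ r + k ∧ r ≤ q + k
  · exact Or.inl (hspec r x (hi r hwin.1 hwin.2) hlx)
  right
  -- If `x` is more than `k` positions away, `g` lists the `k` positions that start at `p` and run
  -- towards `x`. They lie in the block because the shift is good, and in `C` because `C` is
  -- contiguous.
  obtain ⟨g, hginj, hg⟩ : ∃ g : ℕ → ℕ, Set.InjOn g (Finset.range k) ∧ ∀ j < k,
      q ≤ g j + k ∧ g j ≤ q + k ∧ (q ≤ g j ∧ g j ≤ r ∨ r ≤ g j ∧ g j ≤ q) := by
    rcases le_total q r with h | h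
    · exact ⟨fun j => q + j, fun a _ b _ hab => by simpa using hab, fun j hj => by dsimp only; omega⟩
    · refine ⟨fun j => q - j, fun a ha b hb hab => ?_, fun j hj => by dsimp only; omega⟩
      simp only [Finset.coe_range, Set.mem_Iio] at ha hb hab
      omega
  have hglt : ∀ j < k, g j < l.length := fun j hj => by have := hg j hj; omega
  have hfin : {y | y ∈ blockOf k i l p ∧ y ∈ C}.Finite :=
    (List.finite_toSet (blockOf k i l p)).subset fun y hy => hy.1
  set S : Finset P := (Finset.range k).attach.image fun j =>
    l[g j.1]'(hglt _ (Finset.mem_range.1 j.2)) with hS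
  have hScard : S.card = k := by
    rw [hS, Finset.card_image_of_injective, Finset.card_attach, Finset.card_range]
    intro a b hab
    exact Subtype.ext (hginj a.2 b.2 ((hl.getElem_inj_iff).1 hab))
  refine (hScard.ge.trans (Set.ncard_coe_finset S).ge).trans (Set.ncard_le_ncard ?_ hfin)
  intro y hy
  obtain ⟨j, -, rfl⟩ := Finset.mem_image.1 (Finset.mem_coe.1 hy)
  have hj := Finset.mem_range.1 j.2
  have hgj := List.getElem?_eq_getElem (hglt _ hj)
  obtain ⟨h1, h2, h3⟩ := hg j.1 hj
  refine ⟨hspec _ _ (hi _ h1 h2) hgj, ?_⟩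
  rcases h3 with h3 | h3
  · exact hC hlp hgj hlx h3.1 h3.2 hpC hxC
  · exact hC hlx hgj hlp h3.1 h3.2 hxC hpC

end Shift

/-! ### Two-hop neighborhoods and the covering argument -/

section TwoHop

variable {P : Type*} [Finite P]

/-- Points that are reached from `p` by two links inside `S ∪ {p}`. -/
theorem ncard_le_inducedTwoHop {G : SimpleGraph P} {S : Set P} {p : P} {N : Set P}
    (hN : ∀ x ∈ N, x ∈ S ∧ ∃ y ∈ S ∪ {p}, (y = p ∨ G.Adj p y) ∧ (y = x ∨ G.Adj y x)) :
    N.ncard ≤ (inducedTwoHop G S p).ncard := by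
  rw [← Set.ncard_image_of_injective (inducedTwoHop G S p) Subtype.val_injective]
  refine Set.ncard_le_ncard ?_ (Set.toFinite _)
  intro x hx
  obtain ⟨hxS, y, hy, hpy, hyx⟩ := hN x hx
  refine ⟨⟨x, Or.inl hxS⟩, ?_, rfl⟩
  have key : ∀ {u v : ↥(S ∪ {p})}, (u.1 = v.1 ∨ G.Adj u.1 v.1) →
      (G.induce (S ∪ {p})).edist u v ≤ 1 := by
    rintro u v (h | h)
    · rw [Subtype.ext h, SimpleGraph.edist_self]; exact zero_le_one
    · exact (SimpleGraph.edist_eq_one_iff_adj.2 (show (G.induce (S ∪ {p})).Adj u v from h)).le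
  have h1 : (G.induce (S ∪ {p})).edist ⟨p, Or.inr rfl⟩ ⟨y, hy⟩ ≤ 1 :=
    key (hpy.imp Eq.symm id)
  have h2 : (G.induce (S ∪ {p})).edist ⟨y, hy⟩ ⟨x, Or.inl hxS⟩ ≤ 1 := key hyx
  show (G.induce (S ∪ {p})).edist _ _ ≤ _
  exact (SimpleGraph.edist_triangle.trans (add_le_add h1 h2)).trans (by norm_num)

/-- Covering argument: if each of the `k` points of `Q` lies in one of `R` sets `K i`, unless some
`K i` has at least `k` elements, and all `K i` with at least `θ` elements are contained in `N`,
then `N` has at least `k - R * θ` elements. -/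
theorem sub_le_ncard_of_cover {R k : ℕ} {θ : ℝ} {Q N : Set P} (hQ : k ≤ Q.ncard) (hθ : 0 ≤ θ)
    (hθk : θ ≤ k) (K : Fin R → Set P) (hK : ∀ x ∈ Q, ∃ i, (x ∈ K i ∨ k ≤ (K i).ncard) ∧
      (θ ≤ (K i).ncard → K i ⊆ N)) :
    (k : ℝ) - R * θ ≤ N.ncard := by
  classical
  by_cases hbig : ∃ i, k ≤ (K i).ncard ∧ K i ⊆ N
  · obtain ⟨i, hi, hiN⟩ := hbig
    have h1 : k ≤ N.ncard := hi.trans (Set.ncard_le_ncard hiN (Set.toFinite _))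
    have h2 : (k : ℝ) ≤ N.ncard := by exact_mod_cast h1
    have : 0 ≤ (R : ℝ) * θ := by positivity
    linarith
  -- Without a set `K i ⊆ N` of at least `k` elements, each point of `Q` lies in `N` or in some `K
  -- i` of size below `θ`: a `K i` with `k ≥ θ` elements from the hypothesis would be contained in
  -- `N`.
  have hsub : Q ⊆ N ∪ ⋃ i ∈ Finset.univ.filter (fun i => ((K i).ncard : ℝ) < θ), K i := by
    intro x hx
    obtain ⟨i, hxi, hi⟩ := hK x hx
    by_cases hc : θ ≤ (K i).ncard
    · rcases hxi with hxi | hxi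
      · exact Or.inl (hi hc hxi)
      · exact absurd ⟨i, hxi, hi hc⟩ hbig
    · rcases hxi with hxi | hxi
      · refine Or.inr ?_
        simp only [Set.mem_iUnion]
        exact ⟨i, by simpa using hc, hxi⟩
      · exact absurd (hθk.trans (by exact_mod_cast hxi)) hc
  have h1 : k ≤ N.ncard +
      ∑ i ∈ Finset.univ.filter (fun i => ((K i).ncard : ℝ) < θ), (K i).ncard :=
    calc k ≤ Q.ncard := hQ
      _ ≤ _ := Set.ncard_le_ncard hsub (Set.toFinite _)
      _ ≤ _ := Set.ncard_union_le _ _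
      _ ≤ _ := by
        gcongr
        exact Finset.set_ncard_biUnion_le _ _
  have h2 : (k : ℝ) ≤ N.ncard +
      ∑ i ∈ Finset.univ.filter (fun i => ((K i).ncard : ℝ) < θ), ((K i).ncard : ℝ) := by
    exact_mod_cast h1
  have h3 : ∑ i ∈ Finset.univ.filter (fun i => ((K i).ncard : ℝ) < θ), ((K i).ncard : ℝ) ≤
      R * θ := by
    calc _ ≤ ∑ i ∈ Finset.univ.filter (fun i : Fin R => ((K i).ncard : ℝ) < θ), θ :=
          Finset.sum_le_sum fun i hi => (Finset.mem_filter.1 hi).2.le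
      _ ≤ ∑ i : Fin R, θ :=
          Finset.sum_le_sum_of_subset_of_nonneg (Finset.filter_subset _ _) fun _ _ _ => hθ
      _ = R * θ := by simp
  linarith

end TwoHop

/-! ### Fubini estimates on product spaces -/

section Product

variable {X Y : Type*} [MeasurableSpace X] [MeasurableSpace Y]

theorem measurableSet_snd_mem_of_countable {Q : Type*} [Countable Q] {f : X → Q}
    (hf : ∀ q, MeasurableSet (f ⁻¹' {q})) {S : Q → Set Y} (hS : ∀ q, MeasurableSet (S q)) :
    MeasurableSet {z : X × Y | z.2 ∈ S (f z.1)} := by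
  have : {z : X × Y | z.2 ∈ S (f z.1)} = ⋃ q, (f ⁻¹' {q}) ×ˢ S q := by
    ext z
    simp
  rw [this]
  exact MeasurableSet.iUnion fun q => (hf q).prod (hS q)

variable {μ : Measure X} {ν : Measure Y}

theorem prod_apply_le_of_section_le [IsProbabilityMeasure μ] [SFinite ν] {S : Set (X × Y)}
    (hS : MeasurableSet S) {c : ENNReal} (h : ∀ x, ν (Prod.mk x ⁻¹' S) ≤ c) :
    (μ.prod ν) S ≤ c := by
  rw [Measure.prod_apply hS]
  calc _ ≤ ∫⁻ _, c ∂μ := lintegral_mono h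
    _ = c := by simp

theorem mul_le_prod_apply_of_le_section [SFinite ν] {S : Set (X × Y)}
    (hS : MeasurableSet S) {A : Set X} {c : ENNReal}
    (h : ∀ x ∈ A, c ≤ ν (Prod.mk x ⁻¹' S)) : c * μ A ≤ (μ.prod ν) S := by
  rw [Measure.prod_apply hS]
  calc c * μ A = ∫⁻ _ in A, c ∂μ := by simp
    _ ≤ ∫⁻ x in A, ν (Prod.mk x ⁻¹' S) ∂μ :=
      setLIntegral_mono (measurable_measure_prodMk_left hS) h
    _ ≤ _ := setLIntegral_le_lintegral _ _

end Product

/-! ### Probability and measurability of collision events -/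

section Collision

variable {Ω P U : Type*} [MeasurableSpace Ω] {M ℓ : ℕ} {ν : Measure Ω} {h : Ω → P → U} {p x : P}

theorem measurableSet_mem_collisionClass
    (hm : ∀ x y : P, MeasurableSet {ω | h ω x = h ω y}) :
    MeasurableSet {ω : Fin M → Ω | x ∈ collisionClass h ℓ p ω} := by
  have : {ω : Fin M → Ω | x ∈ collisionClass h ℓ p ω} =
      ⋂ j : Fin M, ⋂ _ : (j : ℕ) < ℓ, (fun ω => ω j) ⁻¹' {ω | h ω p = h ω x} := by
    ext ω
    simp [collisionClass]
  rw [this]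
  exact MeasurableSet.iInter fun j => MeasurableSet.iInter fun _ =>
    measurable_pi_apply j (hm p x)

theorem measurableSet_collisionClass_eq [Finite P]
    (hm : ∀ x y : P, MeasurableSet {ω | h ω x = h ω y}) (C : Set P) :
    MeasurableSet {ω : Fin M → Ω | collisionClass h ℓ p ω = C} := by
  have : {ω : Fin M → Ω | collisionClass h ℓ p ω = C} =
      ⋂ x : P, {ω | x ∈ collisionClass h ℓ p ω ↔ x ∈ C} := by
    ext ω
    simp [Set.ext_iff]
  rw [this]
  refine MeasurableSet.iInter fun x => ?_
  by_cases hx : x ∈ C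
  · simpa [hx] using measurableSet_mem_collisionClass hm
  · simp only [hx, iff_false]
    exact (measurableSet_mem_collisionClass hm).compl

/-- The event constrains only the first `ℓ` of the `M` independent coordinates; the others
contribute factors 1. -/
theorem measure_mem_collisionClass [IsProbabilityMeasure ν] (hℓ : ℓ ≤ M) :
    (Measure.pi fun _ : Fin M => ν) {ω | x ∈ collisionClass h ℓ p ω} =
      ENNReal.ofReal (collisionProb ν h ℓ p x) := by
  rw [collisionProb, ofReal_measureReal]
  have h1 : {ω : Fin M → Ω | x ∈ collisionClass h ℓ p ω} =
      Set.univ.pi fun j : Fin M => if (j : ℕ) < ℓ then {ω | h ω p = h ω x} else Set.univ := by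
    ext ω
    simp only [collisionClass, Set.mem_ofPred_eq, Set.mem_pi, Set.mem_univ, true_imp_iff]
    refine forall_congr' fun j => ?_
    split_ifs with hj <;> simp [hj]
  have h2 : {ω : Fin ℓ → Ω | ∀ j, h (ω j) p = h (ω j) x} =
      Set.univ.pi fun _ : Fin ℓ => {ω | h ω p = h ω x} := by
    ext ω
    simp
  rw [h1, h2, Measure.pi_pi, Measure.pi_pi, Finset.prod_const, Finset.card_univ, Fintype.card_fin]
  have : ∀ j : Fin M, ν (if (j : ℕ) < ℓ then {ω | h ω p = h ω x} else Set.univ) =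
      if (j : ℕ) < ℓ then ν {ω | h ω p = h ω x} else 1 := fun j => by
    split_ifs <;> simp
  simp only [this]
  rw [Finset.prod_ite, Finset.prod_const, Finset.prod_const_one, mul_one]
  congr 1
  rw [show (Finset.univ.filter fun j : Fin M => (j : ℕ) < ℓ) =
    Finset.univ.map (Fin.castLEEmb hℓ) from ?_]
  · simp
  · ext j
    simp only [Finset.mem_filter, Finset.mem_univ, true_and, Finset.mem_map]
    exact ⟨fun hj => ⟨⟨j, hj⟩, rfl⟩, by rintro ⟨i, rfl⟩; simp⟩

/-- Union bound: each of the at most `Fintype.card P` points outside `A` collides with probability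
at most `v`. -/
theorem measure_mem_and_subset_ge [IsProbabilityMeasure ν] [Fintype P]
    (hℓ : ℓ ≤ M) {A : Set P} {u v : ℝ}
    (hu : u ≤ collisionProb ν h ℓ p x) (hv : ∀ y ∉ A, collisionProb ν h ℓ p y ≤ v) (hv0 : 0 ≤ v) :
    ENNReal.ofReal (u - Fintype.card P * v) ≤ (Measure.pi fun _ : Fin M => ν)
      {ω | x ∈ collisionClass h ℓ p ω ∧ collisionClass h ℓ p ω ⊆ A} := by
  classical
  have h1 : {ω : Fin M → Ω | x ∈ collisionClass h ℓ p ω ∧ collisionClass h ℓ p ω ⊆ A} =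
      {ω | x ∈ collisionClass h ℓ p ω} \
        ⋃ y ∈ Finset.univ.filter (· ∉ A), {ω | y ∈ collisionClass h ℓ p ω} := by
    ext ω
    simp only [Set.mem_ofPred_eq, Set.mem_sdiff, Set.mem_iUnion, Finset.mem_filter, Finset.mem_univ,
      true_and, exists_prop, not_exists, not_and, and_congr_right_iff]
    exact fun _ => ⟨fun hA y hy hyC => hy (hA hyC), fun hA y hy => by_contra fun hyA => hA y hyA hy⟩
  have h2 : (Measure.pi fun _ : Fin M => ν)
      (⋃ y ∈ Finset.univ.filter (· ∉ A), {ω | y ∈ collisionClass h ℓ p ω}) ≤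
        ENNReal.ofReal (Fintype.card P * v) := by
    refine (measure_biUnion_finset_le _ _).trans ?_
    calc _ ≤ ∑ y ∈ Finset.univ.filter (· ∉ A), ENNReal.ofReal v := by
          refine Finset.sum_le_sum fun y hy => ?_
          rw [measure_mem_collisionClass hℓ]
          exact ENNReal.ofReal_le_ofReal (hv y (Finset.mem_filter.1 hy).2)
      _ ≤ ∑ y : P, ENNReal.ofReal v := Finset.sum_le_sum_of_subset (Finset.filter_subset _ _)
      _ = _ := by
        rw [Finset.sum_const, Finset.card_univ, nsmul_eq_mul, ENNReal.ofReal_mul (by positivity),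
          ENNReal.ofReal_natCast]
  rw [h1]
  refine le_trans ?_ le_measure_sdiff
  rw [measure_mem_collisionClass hℓ, ENNReal.ofReal_sub _ (by positivity)]
  exact tsub_le_tsub (ENNReal.ofReal_le_ofReal hu) h2

variable [LinearOrder U]

theorem measurableSet_hashValues_le (hm : ∀ x y : P, MeasurableSet {ω | h ω x ≤ h ω y}) (x y : P) :
    MeasurableSet {ω : Fin M → Ω | hashValues h ω x ≤ hashValues h ω y} := by
  unfold hashValues
  simp only [← not_lt]
  refine MeasurableSet.compl (s := {ω : Fin M → Ω |
    ((List.finRange M).map fun j => h (ω j) y) < (List.finRange M).map fun j => h (ω j) x}) ?_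
  have hm' : ∀ j : Fin M, ∀ x y : P, MeasurableSet {ω : Fin M → Ω | h (ω j) x ≤ h (ω j) y} :=
    fun j x y => (measurable_pi_apply (X := fun _ : Fin M => Ω) j) (hm x y)
  induction List.finRange M with
  | nil => simp
  | cons j js ih =>
    simp only [List.map_cons, List.cons_lt_cons_iff]
    refine MeasurableSet.union ?_ (MeasurableSet.inter ?_ ih)
    · have := (hm' j x y).compl
      simp only [Set.compl_ofPred, not_le] at this
      exact this
    · simp only [le_antisymm_iff]
      exact (hm' j y x).inter (hm' j x y)

theorem measurableSet_sortedPoints_eq [Finite P]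
    (hm : ∀ x y : P, MeasurableSet {ω | h ω x ≤ h ω y})
    (timeH : Ω → P → ℕ) (pts l : List P) :
    MeasurableSet {ω : Fin M → Ω | (sortedPoints h timeH ω pts).val = l} := by
  classical
  set f : (Fin M → Ω) → P → P → Bool := fun ω x y =>
    decide (hashValues h ω x ≤ hashValues h ω y) with hf
  have h1 : {ω : Fin M → Ω | (sortedPoints h timeH ω pts).val = l} =
      f ⁻¹' {c | (Timed.mergeSort (fun x y => ⟨c x y, 0⟩) pts).val = l} := by
    ext ω
    simp only [sortedPoints_val, hf, Set.mem_ofPred_eq, Set.mem_preimage]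
  have h2 : Measurable f := by
    refine measurable_pi_iff.2 fun x => measurable_pi_iff.2 fun y => ?_
    refine measurable_to_bool ?_
    have : (fun ω => f ω x y) ⁻¹' {true} =
        {ω : Fin M → Ω | hashValues h ω x ≤ hashValues h ω y} := by
      ext ω
      simp [hf]
    rw [this]
    exact measurableSet_hashValues_le hm x y
  rw [h1]
  exact h2 (Set.toFinite _).measurableSet

end Collision

/-! ### Probability that no leader hits a given set -/

section Leaders

theorem measure_uniform_compl_le {m : ℕ} (S : Set (Fin (m + 1))) {θ w : ℝ}
    (hm : (m + 1 : ℝ) ≤ w) (hS : θ ≤ S.ncard) :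
    (PMF.uniformOfFintype (Fin (m + 1))).toMeasure Sᶜ ≤ ENNReal.ofReal (Real.exp (-(θ / w))) := by
  classical
  rw [PMF.toMeasure_uniformOfFintype_apply _ (Set.toFinite _).measurableSet, Fintype.card_compl_set,
    Fintype.card_fin]
  have hc : Fintype.card S = S.ncard := by
    rw [← Nat.card_eq_fintype_card, Nat.card_coe_set_eq]
  have hle : S.ncard ≤ m + 1 := by
    have := Set.ncard_le_card S
    simpa using this
  rw [hc]
  have e : ((m + 1 - S.ncard : ℕ) : ENNReal) / ((m + 1 : ℕ) : ENNReal) =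
      ENNReal.ofReal (1 - S.ncard / (m + 1)) := by
    rw [← ENNReal.ofReal_natCast (m + 1 - S.ncard), ← ENNReal.ofReal_natCast (m + 1),
      ← ENNReal.ofReal_div_of_pos (by positivity), Nat.cast_sub hle]
    congr 1
    push_cast
    field_simp
  rw [e]
  refine ENNReal.ofReal_le_ofReal ?_
  have h1 : θ / w ≤ S.ncard / (m + 1) := by
    gcongr
  have h2 := Real.add_one_le_exp (-(θ / w))
  linarith

/-- Sequences of leaders for which block `B`, with index `j`, has at least `θ` points in `C` but no
leader there. -/
def missingLeaders {P : Type*} (s : ℕ) (θ : ℝ) (B : List P) (C : Set P) (j : ℕ) :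
    Set ((c : ℕ × ℕ × ℕ) → Fin (c.2.2 + 1)) :=
  {L | θ ≤ ({y | y ∈ B ∧ y ∈ C}.ncard : ℝ) ∧
    ∀ t < s, ∀ y, B[(L (j, t, B.length - 1) : ℕ)]? = some y → y ∉ C}

variable {P : Type*} {s : ℕ} {θ : ℝ} {B : List P} {C : Set P} {j : ℕ}

theorem missingLeaders_eq (hθ : θ ≤ ({y | y ∈ B ∧ y ∈ C}.ncard : ℝ)) :
    missingLeaders s θ B C j =
      (((Finset.range s).image fun t => (j, t, B.length - 1) :
        Finset (ℕ × ℕ × ℕ)) : Set (ℕ × ℕ × ℕ)).pi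
        fun c => {i : Fin (c.2.2 + 1) | ∃ y ∈ C, B[(i : ℕ)]? = some y}ᶜ := by
  ext L
  simp only [missingLeaders, hθ, true_and, Set.mem_ofPred_eq, Set.mem_pi, Finset.coe_image,
    Set.mem_image, Finset.coe_range, Set.mem_Iio, Set.mem_compl_iff,
    not_exists, not_and]
  constructor
  · rintro h _ ⟨t, ht, rfl⟩ y hy hB
    exact h t ht y hB hy
  · intro h t ht y hB hy
    exact h _ ⟨t, ht, rfl⟩ y hy hB

theorem measurableSet_missingLeaders (s : ℕ) (θ : ℝ) (B : List P) (C : Set P) (j : ℕ) :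
    MeasurableSet (missingLeaders s θ B C j) := by
  by_cases hθ : θ ≤ ({y | y ∈ B ∧ y ∈ C}.ncard : ℝ)
  · rw [missingLeaders_eq hθ]
    exact MeasurableSet.pi (Finset.countable_toSet _) fun _ _ => (Set.toFinite _).measurableSet
  · convert MeasurableSet.empty
    exact Set.eq_empty_of_forall_notMem fun L hL => hθ hL.1

theorem measure_missingLeaders_le {w : ℝ} (hB : (B.length : ℝ) ≤ w) (hθ : 0 < θ) :
    Measure.infinitePi (fun c : ℕ × ℕ × ℕ => (PMF.uniformOfFintype (Fin (c.2.2 + 1))).toMeasure)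
      (missingLeaders s θ B C j) ≤ ENNReal.ofReal (Real.exp (-(s * (θ / w)))) := by
  by_cases hcard : θ ≤ ({y | y ∈ B ∧ y ∈ C}.ncard : ℝ)
  swap
  · have : missingLeaders s θ B C j = ∅ :=
      Set.eq_empty_of_forall_notMem fun L hL => hcard hL.1
    rw [this]
    simp
  have hne : B ≠ [] := by
    rintro rfl
    simp at hcard
    linarith
  have hpos := List.length_pos_iff.2 hne
  rw [missingLeaders_eq hcard, Measure.infinitePi_pi _ fun _ _ => (Set.toFinite _).measurableSet,
    Finset.prod_image fun a _ b _ hab => by simpa using hab]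
  dsimp only
  -- Leaders are drawn as positions. Every point of `B` in `C` occupies some position, so there are
  -- at least as many favorable positions as points, even if `B` has repetitions.
  have hS : θ ≤ ({i : Fin (B.length - 1 + 1) | ∃ y ∈ C, B[(i : ℕ)]? = some y}.ncard : ℝ) := by
    refine hcard.trans ?_
    have : {y | y ∈ B ∧ y ∈ C} ⊆ (fun i : Fin (B.length - 1 + 1) => B[(i : ℕ)]'(by omega)) ''
        {i : Fin (B.length - 1 + 1) | ∃ y ∈ C, B[(i : ℕ)]? = some y} := by
      rintro y ⟨hy, hyC⟩
      obtain ⟨i, hi, rfl⟩ := List.getElem_of_mem hy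
      exact ⟨⟨i, by omega⟩, ⟨_, hyC, by simp⟩, rfl⟩
    exact_mod_cast (Set.ncard_le_ncard this (Set.toFinite _)).trans (Set.ncard_image_le (Set.toFinite _))
  have h1 := measure_uniform_compl_le _ (w := w) (m := B.length - 1) (by
    rw [Nat.cast_sub (by omega)]; push_cast; linarith) hS
  calc _ ≤ ∏ _t ∈ Finset.range s, ENNReal.ofReal (Real.exp (-(θ / w))) :=
        Finset.prod_le_prod' fun _ _ => h1
    _ = ENNReal.ofReal (Real.exp (-(θ / w))) ^ s := by rw [Finset.prod_const, Finset.card_range]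
    _ = _ := by
      rw [← ENNReal.ofReal_pow (Real.exp_pos _).le, ← Real.exp_nat_mul]
      congr 2
      ring

end Leaders

/-! ### Good and bad random tapes of one repetition -/

section Tapes

variable {Ω P U : Type*} [LinearOrder U]

open Classical in
/-- The tapes for which `x` collides with `p`, all points colliding with `p` lie in `A`, and the
shift is good for `p`. -/
def goodTapes (h : Ω → P → U) (timeH : Ω → P → ℕ) (k M : ℕ) (pts : List P) (A : Set P) (ℓ : ℕ)
    (p x : P) : Set (RepTape Ω k M) :=
  {τ | (x ∈ collisionClass h ℓ p τ.1 ∧ collisionClass h ℓ p τ.1 ⊆ A) ∧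
    τ.2.1 ∈ goodShifts k ((sortedPoints h timeH τ.1 pts).val.idxOf p)}

open Classical in
/-- The tapes for which the block of `p` has at least `θ` points colliding with `p`, none of which
is a leader. -/
def badTapes (h : Ω → P → U) (timeH : Ω → P → ℕ) (k M : ℕ) (pts : List P) (s : ℕ) (θ : ℝ) (ℓ : ℕ)
    (p : P) : Set (RepTape Ω k M) :=
  {τ | τ.2.2 ∈ missingLeaders s θ (blockOf k τ.2.1 (sortedPoints h timeH τ.1 pts).val p)
    (collisionClass h ℓ p τ.1)
    (blockIdx k τ.2.1 ((sortedPoints h timeH τ.1 pts).val.idxOf p))}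

theorem eq_or_adj_of_mem {es : List (P × P × ℝ)} {x y : P} {w : ℝ} (h : (x, y, w) ∈ es) :
    (x = y ∨ (edgeListGraph es).Adj x y) ∧ (y = x ∨ (edgeListGraph es).Adj y x) := by
  by_cases hxy : x = y
  · exact ⟨Or.inl hxy, Or.inl hxy.symm⟩
  · have : (edgeListGraph es).Adj x y := by
      rw [edgeListGraph, SimpleGraph.fromRel_adj]
      exact ⟨hxy, Or.inl ⟨w, h⟩⟩
    exact ⟨Or.inr this, Or.inr this.symm⟩

/-- If every near neighbor of `p` has a good tape and no tape is bad, then the two-hop neighborhood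
of `p` is large. -/
theorem sub_le_ncard_inducedTwoHop [Finite P] {h : Ω → P → U} {timeH : Ω → P → ℕ} {k M R s ℓ : ℕ}
    {μ : P → P → ℝ} {ρ θ : ℝ} {pts : List P} (hpts : pts.Nodup) (hall : ∀ x, x ∈ pts)
    {A Q : Set P} {p : P} (hk : 1 ≤ k) (hQ : k ≤ Q.ncard) (hθ : 0 ≤ θ) (hθk : θ ≤ k)
    {τ : Fin R → RepTape Ω k M}
    (hgood : ∀ x ∈ Q, ∃ i, τ i ∈ goodTapes h timeH k M pts A ℓ p x)
    (hbad : ∀ i, τ i ∉ badTapes h timeH k M pts s θ ℓ p) :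
    (k : ℝ) - R * θ ≤
      (inducedTwoHop (edgeListGraph (stars μ h timeH k M ρ s R pts τ).val) A p).ncard := by
  classical
  set G := edgeListGraph (stars μ h timeH k M ρ s R pts τ).val with hG
  set N : Set P := {x | x ∈ A ∧ ∃ y ∈ A ∪ {p}, (y = p ∨ G.Adj p y) ∧ (y = x ∨ G.Adj y x)} with hN
  refine le_trans ?_ (Nat.cast_le.2 (ncard_le_inducedTwoHop (G := G) (N := N) fun x hx => hx))
  refine sub_le_ncard_of_cover hQ hθ hθk (fun i =>
    {y | y ∈ blockOf k (τ i).2.1 (sortedPoints h timeH (τ i).1 pts).val p ∧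
      y ∈ collisionClass h ℓ p (τ i).1}) fun x hx => ?_
  obtain ⟨i, ⟨hxC, hCA⟩, hshift⟩ := hgood x hx
  have hmem : ∀ y, y ∈ (sortedPoints h timeH (τ i).1 pts).val := fun y =>
    (sortedPoints_perm h timeH (τ i).1 pts).mem_iff.2 (hall y)
  have hi : ((τ i).2.1 : ℕ) ≤ 8 * k := by omega
  have hpB := self_mem_blockOf hk hi (hmem p)
  have hspec := (blockOf_spec hk hi (hmem p)).1
  refine ⟨i, ?_, fun hcard => ?_⟩
  · refine (mem_blockOf_or_le_ncard hk ((sortedPoints_perm h timeH (τ i).1 pts).nodup_iff.2 hpts)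
      (hmem p) (hmem x) (C := collisionClass h ℓ p (τ i).1) ?_
      (self_mem_collisionClass h ℓ p _) hxC hshift).imp (fun hxB => ⟨hxB, hxC⟩) id
    exact fun h1 h2 h3 h4 h5 h6 h7 => mem_collisionClass_of_between h1 h2 h3 h4 h5 h6 h7
  · by_cases hc : (pts.length : ℝ) ^ (2 * ρ) < k
    · have hlead : ∃ t < s, ∃ y, (blockOf k (τ i).2.1 (sortedPoints h timeH (τ i).1 pts).val p)[
          ((τ i).2.2 (blockIdx k (τ i).2.1 ((sortedPoints h timeH (τ i).1 pts).val.idxOf p), t,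
            (blockOf k (τ i).2.1 (sortedPoints h timeH (τ i).1 pts).val p).length - 1) : ℕ)]? = some y ∧ y ∈ collisionClass h ℓ p (τ i).1 := by
        by_contra hcon
        push Not at hcon
        exact hbad i ⟨hcard, fun t ht y hy => hcon t ht y hy⟩
      obtain ⟨t, ht, y, hy, hyC⟩ := hlead
      intro z hz
      refine ⟨hCA hz.2, y, Or.inl (hCA hyC), ?_, ?_⟩
      · exact (eq_or_adj_of_mem (mem_stars (i := i)
          (mem_starsRep_of_leader (μ := μ) hc hspec ht hy hpB))).1.imp Eq.symm id
      · exact (eq_or_adj_of_mem (mem_stars (i := i)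
          (mem_starsRep_of_leader (μ := μ) hc hspec ht hy hz.1))).2
    · intro z hz
      refine ⟨hCA hz.2, p, Or.inr rfl, Or.inl rfl, ?_⟩
      exact (eq_or_adj_of_mem (mem_stars (i := i)
        (mem_starsRep_of_allPairs (μ := μ) hc hspec hpB hz.1))).1

variable [MeasurableSpace Ω] [Fintype P] {ν : Measure Ω} [IsProbabilityMeasure ν] {h : Ω → P → U}
  {timeH : Ω → P → ℕ} {k M s ℓ : ℕ} {pts : List P} {A : Set P} {p x : P} {θ : ℝ}

/-- The hash functions enter only through the pair of collision class and sorted list. As `P` is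
finite, this pair has countably many values, so it suffices to treat each value separately. -/
theorem measurableSet_tape {Y : Type*} [MeasurableSpace Y] [Finite P]
    (hm : ∀ x y : P, MeasurableSet {ω | h ω x ≤ h ω y}) {S : Set P → List P → Set Y}
    (hS : ∀ C l, MeasurableSet (S C l)) :
    MeasurableSet {z : (Fin M → Ω) × Y |
      z.2 ∈ S (collisionClass h ℓ p z.1) (sortedPoints h timeH z.1 pts).val} := by
  have hm' : ∀ x y : P, MeasurableSet {ω | h ω x = h ω y} := fun x y => by
    simp only [le_antisymm_iff]
    exact (hm x y).inter (hm y x)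
  refine measurableSet_snd_mem_of_countable (Q := Set P × List P)
    (f := fun ω => (collisionClass h ℓ p ω, (sortedPoints h timeH ω pts).val))
    (S := fun q => S q.1 q.2) ?_ fun q => hS _ _
  rintro ⟨C, l⟩
  have := (measurableSet_collisionClass_eq (M := M) (ℓ := ℓ) (p := p) hm' C).inter
    (measurableSet_sortedPoints_eq (M := M) hm timeH pts l)
  convert this using 1
  ext ω
  simp

theorem measurableSet_goodTapes (hm : ∀ x y : P, MeasurableSet {ω | h ω x ≤ h ω y}) :
    MeasurableSet (goodTapes h timeH k M pts A ℓ p x) := by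
  classical
  have := measurableSet_tape (M := M) (ℓ := ℓ) (p := p) (timeH := timeH) (pts := pts) hm
    (S := fun C l => {y : Fin (8 * k + 1) × ((c : ℕ × ℕ × ℕ) → Fin (c.2.2 + 1)) |
      (x ∈ C ∧ C ⊆ A) ∧ y.1 ∈ goodShifts k (l.idxOf p)}) fun C l => by
    refine measurable_fst (Set.toFinite {i | (x ∈ C ∧ C ⊆ A) ∧
      i ∈ goodShifts k (l.idxOf p)}).measurableSet
  exact this

theorem measurableSet_badTapes (hm : ∀ x y : P, MeasurableSet {ω | h ω x ≤ h ω y}) :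
    MeasurableSet (badTapes h timeH k M pts s θ ℓ p) := by
  classical
  have := measurableSet_tape (M := M) (ℓ := ℓ) (p := p) (timeH := timeH) (pts := pts) hm
    (S := fun C l => {y : Fin (8 * k + 1) × ((c : ℕ × ℕ × ℕ) → Fin (c.2.2 + 1)) |
      y.2 ∈ missingLeaders s θ (blockOf k y.1 l p) C (blockIdx k y.1 (l.idxOf p))}) fun C l =>
    measurableSet_snd_mem_of_countable (f := id) (fun q => (Set.toFinite _).measurableSet)
      (S := fun i : Fin (8 * k + 1) =>
        missingLeaders s θ (blockOf k i l p) C (blockIdx k i (l.idxOf p)))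
      fun _ => measurableSet_missingLeaders _ _ _ _ _
  exact this

/-- The shift is independent of the hash values, so the condition on it costs a factor of at most 2
once they are fixed. -/
theorem repTapeMeasure_goodTapes_ge (hm : ∀ x y : P, MeasurableSet {ω | h ω x ≤ h ω y})
    (hk : 1 ≤ k) (hℓ : ℓ ≤ M) {u v : ℝ}
    (hu : u ≤ collisionProb ν h ℓ p x) (hv : ∀ y ∉ A, collisionProb ν h ℓ p y ≤ v) (hv0 : 0 ≤ v) :
    ENNReal.ofReal ((u - Fintype.card P * v) / 2) ≤
      repTapeMeasure ν k M (goodTapes h timeH k M pts A ℓ p x) := by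
  classical
  have h1 := measure_mem_and_subset_ge (M := M) hℓ hu hv hv0
  refine le_trans ?_ (mul_le_prod_apply_of_le_section (measurableSet_goodTapes hm) (c := 2⁻¹)
    (A := {ω | x ∈ collisionClass h ℓ p ω ∧ collisionClass h ℓ p ω ⊆ A}) fun ω hω => ?_)
  · rw [div_eq_inv_mul, ENNReal.ofReal_mul (by norm_num), ENNReal.ofReal_inv_of_pos (by norm_num),
      ENNReal.ofReal_ofNat]
    gcongr
  · have hsec : Prod.mk ω ⁻¹' goodTapes h timeH k M pts A ℓ p x =
        (goodShifts k ((sortedPoints h timeH ω pts).val.idxOf p) : Set (Fin (8 * k + 1))) ×ˢ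
          Set.univ := by
      ext y
      simp only [goodTapes, Set.mem_preimage, Set.mem_ofPred_eq, Set.mem_prod, Set.mem_univ,
        and_true, Finset.mem_coe]
      exact ⟨fun hy => by convert hy.2, fun hy => ⟨hω, by convert hy⟩⟩
    rw [hsec, Measure.prod_prod, measure_univ, mul_one,
      PMF.toMeasure_uniformOfFintype_apply _ (Set.toFinite _).measurableSet]
    have hc := card_le_two_mul_card_goodShifts hk ((sortedPoints h timeH ω pts).val.idxOf p)
    rw [ENNReal.le_div_iff_mul_le (by simp) (by simp), ENNReal.inv_mul_le_iff (by simp) (by simp)]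
    simp only [Fintype.card_fin, Finset.coe_sort_coe, Fintype.card_coe]
    exact_mod_cast hc

/-- Fixing the hash functions and the shift fixes the block of `p`, its index and its size, hence
the tape coordinates that hold its leaders. These are independent of what has been fixed. -/
theorem repTapeMeasure_badTapes_le (hm : ∀ x y : P, MeasurableSet {ω | h ω x ≤ h ω y})
    (hall : ∀ x, x ∈ pts) (hk : 1 ≤ k) (hθ : 0 < θ) :
    repTapeMeasure ν k M (badTapes h timeH k M pts s θ ℓ p) ≤
      ENNReal.ofReal (Real.exp (-(s * (θ / (16 * k))))) := by
  classical
  refine prod_apply_le_of_section_le (measurableSet_badTapes hm) fun ω => ?_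
  have hmeas : MeasurableSet (Prod.mk ω ⁻¹' badTapes h timeH k M pts s θ ℓ p) :=
    measurable_prodMk_left (measurableSet_badTapes hm)
  refine prod_apply_le_of_section_le hmeas fun i => ?_
  have hmem : p ∈ (sortedPoints h timeH ω pts).val :=
    (sortedPoints_perm h timeH ω pts).mem_iff.2 (hall p)
  have hsec : Prod.mk i ⁻¹' (Prod.mk ω ⁻¹' badTapes h timeH k M pts s θ ℓ p) =
      missingLeaders s θ (blockOf k i (sortedPoints h timeH ω pts).val p)
        (collisionClass h ℓ p ω) (blockIdx k i ((sortedPoints h timeH ω pts).val.idxOf p)) := rfl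
  have hlen : ((blockOf k i (sortedPoints h timeH ω pts).val p).length : ℝ) ≤ 16 * k := by
    exact_mod_cast blockOf_length_le hk (by omega) hmem
  rw [hsec]
  exact measure_missingLeaders_le hlen hθ

end Tapes

/-! ### Failure probability over all repetitions -/

section Failure

variable {Ω P U : Type*} [LinearOrder U] [MeasurableSpace Ω] [Fintype P] {ν : Measure Ω}
  [IsProbabilityMeasure ν] {h : Ω → P → U}

instance (k M : ℕ) : IsProbabilityMeasure (repTapeMeasure ν k M) := by
  unfold repTapeMeasure; infer_instance

instance (k M R : ℕ) : IsProbabilityMeasure (tapeMeasure ν k M R) := by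
  unfold tapeMeasure; infer_instance

theorem tapeMeasure_forall_notMem_le {k M R : ℕ} {F : Set (RepTape Ω k M)} (hF : MeasurableSet F)
    {g : ℝ} (hg : 0 ≤ g) (hF' : ENNReal.ofReal g ≤ repTapeMeasure ν k M F) :
    tapeMeasure ν k M R {τ | ∀ i, τ i ∉ F} ≤ ENNReal.ofReal (Real.exp (-(R * g))) := by
  have h1 : {τ : Fin R → RepTape Ω k M | ∀ i, τ i ∉ F} = Set.univ.pi fun _ => Fᶜ := by
    ext τ
    simp
  have h2 : repTapeMeasure ν k M Fᶜ ≤ ENNReal.ofReal (Real.exp (-g)) := by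
    rw [prob_compl_eq_one_sub hF]
    calc _ ≤ 1 - ENNReal.ofReal g := tsub_le_tsub_left hF' _
      _ = ENNReal.ofReal (1 - g) := by rw [ENNReal.ofReal_sub _ hg, ENNReal.ofReal_one]
      _ ≤ _ := ENNReal.ofReal_le_ofReal (by linarith [Real.add_one_le_exp (-g)])
  rw [h1, tapeMeasure, Measure.pi_pi, Finset.prod_const, Finset.card_univ, Fintype.card_fin]
  calc _ ≤ ENNReal.ofReal (Real.exp (-g)) ^ R := by gcongr
    _ = _ := by
      rw [← ENNReal.ofReal_pow (Real.exp_pos _).le, ← Real.exp_nat_mul]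
      congr 2
      ring

theorem tapeMeasure_exists_mem_le {k M R : ℕ} {F : Set (RepTape Ω k M)} (hF : MeasurableSet F)
    {e : ENNReal} (hF' : repTapeMeasure ν k M F ≤ e) :
    tapeMeasure ν k M R {τ | ∃ i, τ i ∈ F} ≤ R * e := by
  have h1 : {τ : Fin R → RepTape Ω k M | ∃ i, τ i ∈ F} = ⋃ i, Function.eval i ⁻¹' F := by
    ext τ
    simp
  rw [h1]
  refine (measure_iUnion_fintype_le _ _).trans ?_
  calc _ ≤ ∑ _i : Fin R, e := by
        refine Finset.sum_le_sum fun i _ => ?_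
        exact ((measurePreserving_eval (fun _ : Fin R => repTapeMeasure ν k M) i).measure_preimage
          hF.nullMeasurableSet).trans_le hF'
    _ = _ := by simp

/-- The failure probability of the algorithm, before the choice of the parameters. -/
theorem tapeMeasure_failure_le {timeH : Ω → P → ℕ} {k M R s : ℕ} {μ : P → P → ℝ} {ρ θ δ : ℝ}
    {pts : List P} (hpts : pts.Nodup) (hall : ∀ x, x ∈ pts)
    (hm : ∀ x y : P, MeasurableSet {ω | h ω x ≤ h ω y})
    {π : P → Fin (Fintype.card P) ≃ P} {A : P → Set P} (hA : IsANNFamily ν h π k ρ M A)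
    (hk : 1 ≤ k) (hθ : 0 < θ) (hθk : θ ≤ k) (hRθ : R * θ ≤ δ * k) {g : ℝ} (hg : 0 ≤ g)
    (hg' : g ≤ ((Fintype.card P : ℝ) ^ (-ρ) -
      Fintype.card P * (Fintype.card P : ℝ) ^ (-4 : ℝ)) / 2) :
    tapeMeasure ν k M R {τ | ¬ ∀ p : P, (1 - δ) * k ≤
          ((inducedTwoHop (edgeListGraph (stars μ h timeH k M ρ s R pts τ).val) (A p) p).ncard : ℝ)}
      ≤ Fintype.card P * (Fintype.card P * ENNReal.ofReal (Real.exp (-(R * g))) +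
        R * ENNReal.ofReal (Real.exp (-(s * (θ / (16 * k)))))) := by
  have hsub : {τ : Fin R → RepTape Ω k M | ¬ ∀ p : P, (1 - δ) * k ≤
      ((inducedTwoHop (edgeListGraph (stars μ h timeH k M ρ s R pts τ).val) (A p) p).ncard : ℝ)} ⊆
      ⋃ p : P, {τ | ¬ (1 - δ) * k ≤
        ((inducedTwoHop (edgeListGraph (stars μ h timeH k M ρ s R pts τ).val) (A p) p).ncard : ℝ)} :=
    fun τ hτ => by simpa using hτ
  refine (measure_mono hsub).trans ((measure_iUnion_fintype_le _ _).trans ?_)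
  rw [← nsmul_eq_mul, ← Finset.card_univ, ← Finset.sum_const]
  refine Finset.sum_le_sum fun p _ => ?_
  obtain ⟨⟨m, hkm, hmn, -⟩, ℓ, hℓ, hu, hv⟩ := hA p
  -- The deterministic bound in contrapositive form: failure at `p` means that one of its `k`
  -- nearest neighbors never has a good tape, or that some tape is bad.
  have hsub' : {τ : Fin R → RepTape Ω k M | ¬ (1 - δ) * k ≤
      ((inducedTwoHop (edgeListGraph (stars μ h timeH k M ρ s R pts τ).val) (A p) p).ncard : ℝ)} ⊆
      (⋃ i ∈ Finset.univ.filter (fun i : Fin (Fintype.card P) => (i : ℕ) < k),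
        {τ | ∀ t, τ t ∉ goodTapes h timeH k M pts (A p) ℓ p (π p i)}) ∪
      {τ | ∃ t, τ t ∈ badTapes h timeH k M pts s θ ℓ p} := by
    intro τ hτ
    by_contra hcon
    simp only [Set.mem_union, Set.mem_iUnion, Finset.mem_filter, Finset.mem_univ, true_and,
      Set.mem_ofPred_eq, not_or, not_exists, exists_prop, not_and, not_forall, not_not] at hcon
    refine hτ (le_trans ?_ (sub_le_ncard_inducedTwoHop (μ := μ) (ρ := ρ) hpts hall hk
      (Q := π p '' {i | (i : ℕ) < k}) ?_ hθ.le hθk (τ := τ) ?_ hcon.2))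
    · linarith
    · rw [Set.ncard_image_of_injective _ (π p).injective]
      have : {i : Fin (Fintype.card P) | (i : ℕ) < k} =
          Set.range (Fin.castLE (hkm.trans hmn)) := by
        ext i
        exact ⟨fun hi => ⟨⟨i, hi⟩, rfl⟩, by rintro ⟨j, rfl⟩; exact j.2⟩
      rw [this, ← Set.image_univ, Set.ncard_image_of_injective _ (Fin.castLE_injective _)]
      simp
    · rintro _ ⟨i, hi, rfl⟩
      exact hcon.1 i hi
  refine (measure_mono hsub').trans ((measure_union_le _ _).trans (add_le_add ?_ ?_))
  · refine (measure_biUnion_finset_le _ _).trans ?_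
    calc _ ≤ ∑ i ∈ Finset.univ.filter (fun i : Fin (Fintype.card P) => (i : ℕ) < k),
          ENNReal.ofReal (Real.exp (-(R * g))) := by
          refine Finset.sum_le_sum fun i hi => ?_
          refine tapeMeasure_forall_notMem_le (measurableSet_goodTapes hm) hg ?_
          exact (ENNReal.ofReal_le_ofReal hg').trans (repTapeMeasure_goodTapes_ge hm hk hℓ
            (hu i (Finset.mem_filter.1 hi).2) hv (by positivity))
      _ ≤ ∑ i : Fin (Fintype.card P), ENNReal.ofReal (Real.exp (-(R * g))) :=
          Finset.sum_le_sum_of_subset (Finset.filter_subset _ _)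
      _ = _ := by simp
  · exact tapeMeasure_exists_mem_le (measurableSet_badTapes hm)
      (repTapeMeasure_badTapes_le hm hall hk hθ)

end Failure

/-! ### Numerical estimates for the parameters -/

section Parameters

theorem natCast_eq_exp_log {n : ℕ} (hn : 1 ≤ n) (x : ℝ) :
    (n : ℝ) ^ x = Real.exp (x * Real.log n) := by
  rw [Real.rpow_def_of_pos (by exact_mod_cast hn), mul_comm]

theorem half_le_log {n : ℕ} (hn : 2 ≤ n) : 1 / 2 ≤ Real.log n := by
  have h1 : Real.log 2 ≤ Real.log n := Real.log_le_log (by norm_num) (by exact_mod_cast hn)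
  linarith [Real.log_two_gt_d9]

/-- The union bound loses `n^(-3) ≤ n^(-1) / 2`, at most half of `n^(-ρ)` since `ρ ≤ 1`. -/
theorem good_prob_param_le {n : ℕ} (hn : 2 ≤ n) {ρ : ℝ} (hρ : ρ ≤ 1) :
    (n : ℝ) ^ (-ρ) / 4 ≤ ((n : ℝ) ^ (-ρ) - n * (n : ℝ) ^ (-4 : ℝ)) / 2 := by
  have hn' : (2 : ℝ) ≤ n := by exact_mod_cast hn
  have hpos : (0 : ℝ) < n := by linarith
  have h1 : (n : ℝ) ^ (-1 : ℝ) ≤ (n : ℝ) ^ (-ρ) :=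
    Real.rpow_le_rpow_of_exponent_le (by linarith) (by linarith)
  have h2 : (n : ℝ) * (n : ℝ) ^ (-4 : ℝ) = (n : ℝ) ^ (-1 : ℝ) * ((n : ℝ) ^ 2)⁻¹ := by
    rw [Real.rpow_neg_one, Real.rpow_neg hpos.le, show (4 : ℝ) = (4 : ℕ) by norm_num,
      Real.rpow_natCast]
    field_simp
  have h3 : ((n : ℝ) ^ 2)⁻¹ ≤ 1 / 2 := by
    rw [inv_eq_one_div]
    exact one_div_le_one_div_of_le (by norm_num) (by nlinarith)
  have h4 : 0 < (n : ℝ) ^ (-1 : ℝ) := by positivity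
  rw [h2]
  nlinarith

theorem numReps_le {c₁ ρ : ℝ} {n : ℕ} (hn : 1 ≤ n) (hc : 0 ≤ c₁) :
    (numReps c₁ ρ n : ℝ) ≤ c₁ * (n : ℝ) ^ ρ * Real.log n + 1 := by
  have : 0 ≤ Real.log n := Real.log_natCast_nonneg n
  exact (Nat.ceil_lt_add_one (by positivity)).le

theorem numLeaders_le {c₂ δ ρ : ℝ} {n : ℕ} (hc : 0 ≤ c₂) (hδ : 0 < δ) :
    (numLeaders c₂ δ ρ n : ℝ) ≤ c₂ * δ⁻¹ * (n : ℝ) ^ ρ * Real.log n ^ 2 + 1 :=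
  (Nat.ceil_lt_add_one (by positivity)).le

theorem numReps_le_two_mul {c₁ ρ : ℝ} {n : ℕ} (hn : 2 ≤ n) (hc : 2 ≤ c₁) (hρ : 0 ≤ ρ) :
    (numReps c₁ ρ n : ℝ) ≤ 2 * (c₁ * (n : ℝ) ^ ρ * Real.log n) := by
  have h1 := numReps_le (ρ := ρ) (by omega : 1 ≤ n) (by linarith : 0 ≤ c₁)
  have h2 := half_le_log hn
  have h3 : 1 ≤ (n : ℝ) ^ ρ := Real.one_le_rpow (by exact_mod_cast (by omega : 1 ≤ n)) hρ
  have h4 : 2 ≤ c₁ * (n : ℝ) ^ ρ := by nlinarith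
  nlinarith

theorem exp_numReps_le {c₁ ρ a : ℝ} {n : ℕ} (hn : 2 ≤ n) (hc : 4 * a + 20 ≤ c₁) :
    Real.exp (-(numReps c₁ ρ n * ((n : ℝ) ^ (-ρ) / 4))) ≤ (n : ℝ) ^ (-(a + 3)) := by
  have hpos : (0 : ℝ) < n := by exact_mod_cast (by omega : 0 < n)
  have hL := half_le_log hn
  rw [natCast_eq_exp_log (by omega) (-(a + 3)), Real.exp_le_exp, neg_mul, neg_le_neg_iff]
  have h1 : c₁ * (n : ℝ) ^ ρ * Real.log n ≤ numReps c₁ ρ n := Nat.le_ceil _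
  have h2 : (0 : ℝ) < (n : ℝ) ^ ρ := by positivity
  rw [Real.rpow_neg hpos.le]
  calc (a + 3) * Real.log n ≤ c₁ * Real.log n / 4 := by nlinarith
    _ = c₁ * (n : ℝ) ^ ρ * Real.log n * (((n : ℝ) ^ ρ)⁻¹ / 4) := by field_simp
    _ ≤ _ := by gcongr

theorem numReps_pos {c₁ ρ : ℝ} {n : ℕ} (hn : 2 ≤ n) (hc : 0 < c₁) : 0 < numReps c₁ ρ n := by
  have hpos : (0 : ℝ) < n := by exact_mod_cast (by omega : 0 < n)
  have hL := half_le_log hn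
  exact Nat.ceil_pos.2 (by have : 0 < Real.log n := by linarith
                           positivity)

/-- With `θ = δ k / R` the exponent becomes `s δ / (16 R)`, in which `k` cancels. As `s` carries one
more logarithm than `R`, the exponent is a multiple of `log n`, and `c₂ ≥ 256 c₁²` makes it at least
`8 c₁ log n`; here `256 = 8 * 16 * 2`. -/
theorem numReps_mul_exp_numLeaders_le {c₁ c₂ ρ δ a : ℝ} {n k : ℕ} (hn : 2 ≤ n) (hk : 1 ≤ k)
    (ha : 0 < a) (hc₁ : 4 * a + 20 ≤ c₁) (hc₂ : 256 * c₁ ^ 2 ≤ c₂) (hρ0 : 0 ≤ ρ) (hρ : ρ ≤ 1)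
    (hδ : 0 < δ) :
    (numReps c₁ ρ n : ℝ) * Real.exp (-(numLeaders c₂ δ ρ n *
      (δ * k / numReps c₁ ρ n / (16 * k)))) ≤ (n : ℝ) ^ (-(a + 2)) := by
  have hpos : (0 : ℝ) < n := by exact_mod_cast (by omega : 0 < n)
  have hk' : (0 : ℝ) < k := by exact_mod_cast hk
  have hL := half_le_log hn
  have hL0 : 0 < Real.log n := by linarith
  have hc0 : 0 < c₁ := by linarith
  have hX : (0 : ℝ) < (n : ℝ) ^ ρ := by positivity
  have hR0 : (0 : ℝ) < numReps c₁ ρ n := by exact_mod_cast numReps_pos hn hc0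
  have hR := numReps_le_two_mul (ρ := ρ) hn (by linarith : 2 ≤ c₁) hρ0
  have hs : c₂ * δ⁻¹ * (n : ℝ) ^ ρ * Real.log n ^ 2 ≤ numLeaders c₂ δ ρ n := Nat.le_ceil _
  have h1 : 8 * c₁ * Real.log n ≤ numLeaders c₂ δ ρ n * (δ * k / numReps c₁ ρ n / (16 * k)) := by
    have e1 : (numLeaders c₂ δ ρ n : ℝ) * (δ * k / numReps c₁ ρ n / (16 * k)) =
        numLeaders c₂ δ ρ n * δ / (16 * numReps c₁ ρ n) := by field_simp
    rw [e1, le_div_iff₀ (by positivity)]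
    calc 8 * c₁ * Real.log n * (16 * numReps c₁ ρ n)
        ≤ 8 * c₁ * Real.log n * (16 * (2 * (c₁ * (n : ℝ) ^ ρ * Real.log n))) := by gcongr
      _ = 256 * c₁ ^ 2 * δ⁻¹ * (n : ℝ) ^ ρ * Real.log n ^ 2 * δ := by field_simp; ring
      _ ≤ c₂ * δ⁻¹ * (n : ℝ) ^ ρ * Real.log n ^ 2 * δ := by gcongr
      _ ≤ _ := by gcongr
  have h2 : (numReps c₁ ρ n : ℝ) ≤ Real.exp ((4 * c₁ + 2) * Real.log n) := by
    -- Since `log n ≥ 1/2`, the constant `2 * c₁` is itself absorbed into a power of `n`.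
    have e1 : 2 * c₁ ≤ Real.exp (4 * c₁ * Real.log n) := by
      have := Real.add_one_le_exp (4 * c₁ * Real.log n)
      nlinarith
    have e2 : (n : ℝ) ^ ρ ≤ Real.exp (Real.log n) := by
      rw [Real.exp_log hpos]
      calc (n : ℝ) ^ ρ ≤ (n : ℝ) ^ (1 : ℝ) :=
            Real.rpow_le_rpow_of_exponent_le (by exact_mod_cast (by omega : 1 ≤ n)) hρ
        _ = n := Real.rpow_one _
    have e3 : Real.log n ≤ Real.exp (Real.log n) := by linarith [Real.add_one_le_exp (Real.log n)]
    calc (numReps c₁ ρ n : ℝ) ≤ 2 * c₁ * (n : ℝ) ^ ρ * Real.log n := by linarith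
      _ ≤ Real.exp (4 * c₁ * Real.log n) * Real.exp (Real.log n) * Real.exp (Real.log n) := by
        gcongr
      _ = _ := by rw [← Real.exp_add, ← Real.exp_add]; congr 1; ring
  calc _ ≤ Real.exp ((4 * c₁ + 2) * Real.log n) * Real.exp (-(8 * c₁ * Real.log n)) := by gcongr
    _ = Real.exp ((2 - 4 * c₁) * Real.log n) := by rw [← Real.exp_add]; congr 1; ring
    _ ≤ _ := by
      rw [natCast_eq_exp_log (by omega), Real.exp_le_exp]
      nlinarith

theorem clog_add_one_le {n : ℕ} (hn : 1 ≤ n) :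
    ((Nat.clog 2 n : ℕ) : ℝ) + 1 ≤ 2 * (1 + Real.log n) := by
  have hL : 0 ≤ Real.log n := Real.log_natCast_nonneg n
  have h1 : Real.logb 2 n ≤ 2 * Real.log n := by
    rw [Real.logb, div_le_iff₀ (Real.log_pos (by norm_num))]
    nlinarith [Real.log_two_gt_d9]
  have h2 : ((Nat.clog 2 n : ℕ) : ℝ) ≤ Real.logb 2 n + 1 := by
    have := Real.natCeil_logb_natCast 2 n
    rw [← this]
    exact (Nat.ceil_lt_add_one (by
      exact Real.logb_nonneg (by norm_num) (by exact_mod_cast hn))).le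
  linarith

set_option maxHeartbeats 800000 in
theorem resource_bounds {n k M T R s : ℕ} {c₁ c₂ ρ δ : ℝ} (hn : 1 ≤ n) (hM : 1 ≤ M) (hT : 1 ≤ T)
    (hc₁ : 0 ≤ c₁) (hc₂ : 0 ≤ c₂) (hρ : 0 ≤ ρ) (hδ : 0 < δ) (hδ1 : δ < 1)
    (hR : R = numReps c₁ ρ n) (hs : s = numLeaders c₂ δ ρ n) :
    ∃ E : ℕ, 1 ≤ E ∧ ((n : ℝ) ^ (2 * ρ) < k → s ≤ E) ∧
      (¬ (n : ℝ) ^ (2 * ρ) < k → 16 * k ≤ E) ∧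
      ((R * (E * n) : ℕ) : ℝ) ≤ (c₁ + 2) * (100 + 24 * (c₂ + 18)) * δ⁻¹ *
        (n : ℝ) ^ (1 + 3 * ρ) * (1 + Real.log n) ^ 3 ∧
      ((R * ((M + 8 + ((T + 1) * M + 7) * n + (M + 5) * n * (Nat.clog 2 n + 1) +
        E * (17 * n + 6)) + E * n + 1) + 1 : ℕ) : ℝ) ≤
        (c₁ + 2) * (100 + 24 * (c₂ + 18)) * δ⁻¹ * (n : ℝ) ^ (1 + 3 * ρ) *
          (1 + Real.log n) ^ 3 * M * T := by
  have hn' : (1 : ℝ) ≤ n := by exact_mod_cast hn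
  have hM' : (1 : ℝ) ≤ M := by exact_mod_cast hM
  have hT' : (1 : ℝ) ≤ T := by exact_mod_cast hT
  have hL : 0 ≤ Real.log n := Real.log_natCast_nonneg n
  have hX : 1 ≤ (n : ℝ) ^ ρ := Real.one_le_rpow hn' hρ
  have hX2 : (n : ℝ) ^ (2 * ρ) = ((n : ℝ) ^ ρ) ^ 2 := by
    rw [mul_comm, Real.rpow_mul (by linarith), show (2 : ℝ) = (2 : ℕ) by norm_num,
      Real.rpow_natCast]
  have hX3 : (n : ℝ) ^ (1 + 3 * ρ) = n * ((n : ℝ) ^ ρ) ^ 3 := by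
    rw [Real.rpow_add (by linarith), Real.rpow_one, mul_comm (3 : ℝ), Real.rpow_mul (by linarith),
      show (3 : ℝ) = (3 : ℕ) by norm_num, Real.rpow_natCast]
  have hd : 1 ≤ δ⁻¹ := (one_le_inv₀ hδ).2 hδ1.le
  have hRle := numReps_le (ρ := ρ) hn hc₁
  have hsle := numLeaders_le (ρ := ρ) (n := n) hc₂ hδ
  have hclog := clog_add_one_le hn
  rw [← hR] at hRle
  rw [← hs] at hsle
  rw [hX2, hX3]
  generalize (n : ℝ) ^ ρ = X at *
  generalize Real.log n = L at *
  generalize Nat.clog 2 n = K at *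
  -- `Z` bounds the work per point in one repetition, up to constants: `X ^ 2` covers the all-pairs
  -- branch, and `δ⁻¹ * X * L ^ 2` the leaders.
  set Z : ℝ := δ⁻¹ * X ^ 2 * (1 + L) ^ 2 with hZ
  have hXX : X ≤ X ^ 2 := by nlinarith
  have hX21 : 1 ≤ X ^ 2 := by nlinarith
  have hLL : 1 ≤ (1 + L) ^ 2 := by nlinarith
  have hLZ : 1 + L ≤ Z := by
    calc 1 + L = 1 * 1 * (1 + L) := by ring
      _ ≤ δ⁻¹ * X ^ 2 * (1 + L) ^ 2 := by gcongr; nlinarith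
  have hZX : X ^ 2 ≤ Z := by
    calc X ^ 2 = 1 * X ^ 2 * 1 := by ring
      _ ≤ _ := by rw [hZ]; gcongr
  obtain ⟨E, hE1, hEs, hEk, hEZ⟩ : ∃ E : ℕ, 1 ≤ E ∧ (X ^ 2 < k → s ≤ E) ∧
      (¬ X ^ 2 < k → 16 * k ≤ E) ∧ (E : ℝ) ≤ (c₂ + 18) * Z := by
    have hsZ : (s : ℝ) ≤ c₂ * Z + 1 := by
      refine hsle.trans ?_
      have : c₂ * δ⁻¹ * X * L ^ 2 ≤ c₂ * δ⁻¹ * X ^ 2 * (1 + L) ^ 2 := by gcongr; linarith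
      calc _ ≤ c₂ * δ⁻¹ * X ^ 2 * (1 + L) ^ 2 + 1 := by linarith
        _ = _ := by rw [hZ]; ring
    by_cases hc : X ^ 2 < k
    · refine ⟨s + 1, by omega, fun _ => by omega, fun h => absurd hc h, ?_⟩
      push_cast
      nlinarith
    · refine ⟨16 * k + 1, by omega, fun h => absurd h hc, fun _ => by omega, ?_⟩
      push_cast
      have : 0 ≤ c₂ * Z := by positivity
      nlinarith
  have hR' : (R : ℝ) + 1 ≤ (c₁ + 2) * (X * (1 + L)) := by
    have h1 : 1 ≤ X * (1 + L) := by nlinarith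
    have h2 : c₁ * X * L ≤ c₁ * (X * (1 + L)) := by
      rw [mul_assoc]
      gcongr
      linarith
    linarith
  refine ⟨E, hE1, hEs, hEk, ?_, ?_⟩
  · push_cast
    calc (R : ℝ) * (E * n) ≤ ((c₁ + 2) * (X * (1 + L))) * ((c₂ + 18) * Z * n) := by
          gcongr
          linarith
      _ ≤ ((c₁ + 2) * (X * (1 + L))) * ((100 + 24 * (c₂ + 18)) * Z * n) := by
        have : c₂ + 18 ≤ 100 + 24 * (c₂ + 18) := by linarith
        gcongr
      _ = _ := by rw [hZ]; ring
  · set Y : ℝ := M * T * n with hY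
    have hMT : (1 : ℝ) ≤ M * T := by nlinarith
    have hMM : (M : ℝ) ≤ M * T := by nlinarith
    have hMY : (M : ℝ) * n ≤ Y := by rw [hY]; gcongr
    have hnY : (n : ℝ) ≤ Y := by nlinarith
    have hY1 : 1 ≤ Y := hn'.trans hnY
    have hMY' : (M : ℝ) ≤ Y := by nlinarith
    have b1 : ((T : ℝ) + 1) * M * n + 7 * n ≤ 9 * Y := by
      have : ((T : ℝ) + 1) * M * n = Y + M * n := by rw [hY]; ring
      linarith
    have b2 : ((M : ℝ) + 5) * n * (K + 1) ≤ 12 * (Y * Z) := by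
      have h1 : ((M : ℝ) + 5) * n ≤ 6 * Y := by linarith
      calc ((M : ℝ) + 5) * n * (K + 1) ≤ (6 * Y) * (2 * (1 + L)) :=
            mul_le_mul h1 hclog (by positivity) (by positivity)
        _ = 12 * (Y * (1 + L)) := by ring
        _ ≤ _ := by gcongr
    have hZ1 : 1 ≤ Z := hX21.trans hZX
    have b3 : (E : ℝ) * (17 * n + 6) + E * n ≤ 24 * (c₂ + 18) * (Y * Z) := by
      calc (E : ℝ) * (17 * n + 6) + E * n = E * (18 * n + 6) := by ring
        _ ≤ ((c₂ + 18) * Z) * (24 * Y) := by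
          gcongr
          linarith
        _ = _ := by ring
    have hYZ : Y ≤ Y * Z := by nlinarith
    have hYZ1 : 1 ≤ Y * Z := hY1.trans hYZ
    have hsum : ((M : ℝ) + 8 + ((T + 1) * M + 7) * n + (M + 5) * n * (K + 1) +
        E * (17 * n + 6)) + E * n + 1 ≤ (100 + 24 * (c₂ + 18)) * (Y * Z) := by
      nlinarith
    push_cast
    have hge : (1 : ℝ) ≤ ((M : ℝ) + 8 + ((T + 1) * M + 7) * n + (M + 5) * n * (K + 1) +
        E * (17 * n + 6)) + E * n + 1 := by
      have : (0 : ℝ) ≤ ((M : ℝ) + 8 + ((T + 1) * M + 7) * n + (M + 5) * n * (K + 1) +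
        E * (17 * n + 6)) + E * n := by positivity
      linarith
    calc (R : ℝ) * (((M : ℝ) + 8 + ((T + 1) * M + 7) * n + (M + 5) * n * (K + 1) +
          E * (17 * n + 6)) + E * n + 1) + 1
        ≤ (R + 1) * (((M : ℝ) + 8 + ((T + 1) * M + 7) * n + (M + 5) * n * (K + 1) +
          E * (17 * n + 6)) + E * n + 1) := by linarith
      _ ≤ ((c₁ + 2) * (X * (1 + L))) * ((100 + 24 * (c₂ + 18)) * (Y * Z)) := by gcongr
      _ = _ := by rw [hZ, hY]; ring

end Parameters

/-! ### Assembly of the theorem -/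

theorem mainTheorem2 :
    ∃ (κ : ℝ) (b : ℕ) (f : ℝ → ℝ), ∀ a : ℝ, 0 < a →
    ∃ c₁₀ : ℝ, 0 < c₁₀ ∧ ∀ c₁ : ℝ, c₁₀ ≤ c₁ →
    ∀ c₂ : ℝ, f c₁ ≤ c₂ →
    ∃ C : ℝ, 0 < C ∧
    ∀ (P : Type*) [Fintype P] [Nonempty P] (μ : P → P → ℝ)
      (π : P → Fin (Fintype.card P) ≃ P), IsNeighborOrdering μ π →
    ∀ (U : Type*) [LinearOrder U] (Ω : Type*) [MeasurableSpace Ω]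
      (ν : Measure Ω) [IsProbabilityMeasure ν] (h : Ω → P → U),
      (∀ x y : P, MeasurableSet {ω | h ω x ≤ h ω y}) →
    ∀ (timeH : Ω → P → ℕ) (T : ℕ), 1 ≤ T → (∀ ω x, timeH ω x ≤ T) →
    ∀ (k M : ℕ) (ρ δ : ℝ), 1 ≤ k → 1 ≤ M → 0 ≤ ρ → ρ ≤ 1 → 0 < δ → δ < 1 →
    ∀ A : P → Set P, IsANNFamily ν h π k ρ M A →
    ∀ pts : List P, pts.Nodup → (∀ x, x ∈ pts) →
    ∀ (n R s : ℕ), n = Fintype.card P → R = numReps c₁ ρ n → s = numLeaders c₂ δ ρ n →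
      tapeMeasure ν k M R {τ | ¬ ∀ p : P, (1 - δ) * k ≤
          ((inducedTwoHop (edgeListGraph (stars μ h timeH k M ρ s R pts τ).val) (A p) p).ncard : ℝ)}
        ≤ ENNReal.ofReal ((n : ℝ) ^ (-a)) ∧
      ∀ τ : Fin R → RepTape Ω k M,
        ((edgeListGraph (stars μ h timeH k M ρ s R pts τ).val).edgeSet.ncard : ℝ)
          ≤ C * δ⁻¹ * (n : ℝ) ^ (1 + κ * ρ) * (1 + Real.log n) ^ b ∧
        ((stars μ h timeH k M ρ s R pts τ).time : ℝ)
          ≤ C * δ⁻¹ * (n : ℝ) ^ (1 + κ * ρ) * (1 + Real.log n) ^ b * M * T := by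
  -- The repetitions contribute `n^ρ` and one logarithm; the work per point contributes at most
  -- `n^(2ρ)` and two logarithms.
  refine ⟨3, 3, fun c₁ => 256 * c₁ ^ 2, fun a ha => ⟨4 * a + 20, by linarith,
    fun c₁ hc₁ c₂ hc₂ => ⟨(c₁ + 2) * (100 + 24 * (c₂ + 18)), ?_, ?_⟩⟩⟩
  · have : 0 ≤ c₂ := le_trans (by positivity) hc₂
    have : 0 ≤ c₁ := by linarith
    positivity
  intro P _ _ μ π _ U _ Ω _ ν _ h hm timeH T hT htime k M ρ δ hk hM hρ0 hρ hδ hδ1 A hA pts hpts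
    hall n R s hn hR hs
  have hc₁0 : 0 < c₁ := by linarith
  have hc₂0 : 0 ≤ c₂ := le_trans (by positivity) hc₂
  have hn1 : 1 ≤ n := hn ▸ Fintype.card_pos
  have hlen : pts.length = n := by
    classical
    rw [hn, ← List.toFinset_card_of_nodup hpts, ← Finset.card_univ]
    congr 1
    ext x
    simpa using hall x
  refine ⟨?_, fun τ => ?_⟩
  -- For `n = 1` the claimed bound is 1. Otherwise `log n ≥ 1/2` is available and `R` is positive.
  · rcases hn1.eq_or_lt with h1 | h2
    · rw [← h1, Nat.cast_one, Real.one_rpow, ENNReal.ofReal_one]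
      exact prob_le_one
    · have hR0 : 0 < R := hR ▸ numReps_pos h2 hc₁0
      have hR1 : (1 : ℝ) ≤ R := by exact_mod_cast hR0
      have hk' : (0 : ℝ) < k := by exact_mod_cast hk
      have hpos : (0 : ℝ) < n := by exact_mod_cast hn1
      -- This `θ` makes the total loss `R * θ` exactly `δ * k`.
      refine (tapeMeasure_failure_le hpts hall hm hA hk (θ := δ * k / R) (by positivity) ?_ ?_
        (g := (n : ℝ) ^ (-ρ) / 4) (by positivity) ?_).trans ?_
      · rw [div_le_iff₀ (by linarith)]
        nlinarith
      · rw [mul_div_cancel₀ _ (by linarith)]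
      · rw [← hn]
        exact good_prob_param_le h2 hρ
      · rw [← hn, ← ENNReal.ofReal_natCast n, ← ENNReal.ofReal_natCast R,
          ← ENNReal.ofReal_mul (by positivity), ← ENNReal.ofReal_mul (by positivity),
          ← ENNReal.ofReal_add (by positivity) (by positivity),
          ← ENNReal.ofReal_mul (by positivity)]
        refine ENNReal.ofReal_le_ofReal ?_
        have b1 := exp_numReps_le (ρ := ρ) h2 hc₁
        have b2 := numReps_mul_exp_numLeaders_le h2 hk ha hc₁ hc₂ hρ0 hρ hδ
        rw [← hR] at b1 b2
        rw [← hs] at b2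
        have e1 : (n : ℝ) * (n : ℝ) ^ (-(a + 3)) = (n : ℝ) ^ (-(a + 2)) := by
          rw [show -(a + 2) = 1 + -(a + 3) by ring, Real.rpow_add hpos, Real.rpow_one]
        have e2 : (n : ℝ) * n * (n : ℝ) ^ (-(a + 2)) = (n : ℝ) ^ (-a) := by
          rw [show -a = 1 + (1 + -(a + 2)) by ring, Real.rpow_add hpos, Real.rpow_add hpos,
            Real.rpow_one, mul_assoc]
        have hn2 : (2 : ℝ) ≤ n := by exact_mod_cast h2
        -- Both kinds of failure contribute `n^(-(a + 2))` per point; the resulting factor 2 is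
        -- absorbed by `n ≥ 2`.
        calc _ ≤ (n : ℝ) * (n * (n : ℝ) ^ (-(a + 3)) + (n : ℝ) ^ (-(a + 2))) := by gcongr
          _ = 2 * (n * (n : ℝ) ^ (-(a + 2))) := by rw [e1]; ring
          _ ≤ n * (n * (n : ℝ) ^ (-(a + 2))) := by gcongr
          _ = _ := by rw [← e2]; ring
  · have hne : pts ≠ [] := by
      rw [← List.length_pos_iff]
      omega
    obtain ⟨E, hE1, hEs, hEk, hedges, htimes⟩ := resource_bounds (k := k) hn1 hM hT hc₁0.le hc₂0
      hρ0 hδ hδ1 hR hs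
    rw [← hlen] at hEs hEk
    have hL : ∀ i, (starsRep μ h timeH k M ρ s pts (τ i)).val.length ≤ E * n := fun i =>
      hlen ▸ starsRep_length_le hk (τ i) hEs hEk
    have hD := fun i => starsRep_time_le (μ := μ) (h := h) htime hne hk (τ i) hE1 hEs hEk
    rw [hlen] at hD
    refine ⟨le_trans ?_ hedges, le_trans ?_ htimes⟩
    · exact_mod_cast (edgeListGraph_ncard_le _).trans (stars_length_le hL)
    · exact_mod_cast stars_time_le hL hD
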